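/- Let $G$ be a finite or infinite connected simple graph of maximum valence $3$, that is, every vertex has at most three neighbors and some vertex has exactly three. Suppose that $G$ contains a cycle and that its girth (the length of its shortest cycle) is at least $6$. Let $D(G)$ denote the distinguishing number of $G$, that is, the least number $k$ for which the vertices of $G$ can be colored with $k$ colors (not necessarily properly) so that the only automorphism of $G$ preserving all colors is the identity. Then $D(G)\le 2$; moreover, $D(G)=2$ if and only if $G$ has a non-identity automorphism. -/

import Mathlib

/-- `G` has maximum valence `d`: every vertex has at most `d` neighbors, and some vertex has
exactly `d` neighbors. The graph may be finite or infinite. -/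
def HasMaxValence {V : Type*} (G : SimpleGraph V) (d : ℕ) : Prop :=
  (∀ v, (G.neighborSet v).encard ≤ d) ∧ ∃ v, (G.neighborSet v).encard = d

/-- A (not necessarily proper) vertex coloring `c` of `G` is distinguishing if the only
automorphism of `G` that preserves the colors is the identity. -/
def IsDistinguishing {V C : Type*} (G : SimpleGraph V) (c : V → C) : Prop :=
  ∀ φ : G ≃g G, (∀ v, c (φ v) = c v) → ∀ v, φ v = v

/-- The distinguishing number `D(G)`: the least `k` for which there is a distinguishing coloring
of the vertices of `G` with `k` colors (and `⊤` if no finite number of colors suffices). -/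
noncomputable def distinguishingNumber {V : Type*} (G : SimpleGraph V) : ℕ∞ :=
  ⨅ (k : ℕ) (_ : ∃ c : V → Fin k, IsDistinguishing G c), (k : ℕ∞)

/-!
By breadth-first search from a set `B` in a graph of girth at least five, an automorphism that
fixes `B` pointwise either fixes a vertex whose parents it fixes or exchanges it with a *twin*, a
vertex with the same single parent. In valence three twins come in pairs, so coloring the two
twins differently leaves only the task of forcing `B` to be fixed. Two matchings can be separated
by the same two colors, which leaves enough freedom for this: `B` is a vertex of valence two if
there is one, and otherwise a shortest cycle, on which the colors of the side vertices break the
symmetry. The one cubic graph that escapes is the Heawood graph, where all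
opposite side vertices of hexagons are adjacent. Vertices outside the 2-core are again handled by
breadth-first search, starting from the 2-core.
-/

namespace SubcubicGraph

open SimpleGraph

variable {V : Type*} {G : SimpleGraph V}

/-- A set of vertices that only the trivial automorphism preserves: a color class of a
distinguishing coloring with two colors. -/
def IsDistinguishingSet (G : SimpleGraph V) (S : Set V) : Prop :=
  ∀ φ : G ≃g G, (∀ v, φ v ∈ S ↔ v ∈ S) → ∀ v, φ v = v

section Sets

variable {α : Type*} {s : Set α} {a b c : α}

theorem eq_pair_of_encard_le_two (hs : s.encard ≤ 2) (ha : a ∈ s) (hb : b ∈ s) (hab : a ≠ b) :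
    s = {a, b} := by
  refine (Set.Finite.eq_of_subset_of_encard_le (Set.toFinite _) (Set.pair_subset ha hb) ?_).symm
  rwa [Set.encard_pair hab]

theorem eq_triple_of_encard_le_three (hs : s.encard ≤ 3) (ha : a ∈ s) (hb : b ∈ s) (hc : c ∈ s)
    (hab : a ≠ b) (hac : a ≠ c) (hbc : b ≠ c) : s = {a, b, c} := by
  refine (Set.Finite.eq_of_subset_of_encard_le (Set.toFinite _)
    (Set.insert_subset ha (Set.pair_subset hb hc)) ?_).symm
  rwa [Set.encard_eq_three.mpr ⟨a, b, c, hab, hac, hbc, rfl⟩]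

end Sets

section Girth

theorem egirth_le_of_isPath_of_ne {v w : V} {p q : G.Walk v w} (hp : p.IsPath) (hq : q.IsPath)
    (hpq : p ≠ q) : G.egirth ≤ (p.length + q.length : ℕ) := by
  let H := fromEdgeSet {e | e ∈ p.edges ++ q.edges}
  have hedges : {e | e ∈ p.edges ++ q.edges} ⊆ G.edgeSet := by
    intro e he
    rcases List.mem_append.mp he with he | he
    exacts [p.edges_subset_edgeSet he, q.edges_subset_edgeSet he]
  have hH : H.edgeSet = {e | e ∈ p.edges ++ q.edges} := by
    rw [edgeSet_fromEdgeSet, sdiff_eq_left, Set.disjoint_left]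
    exact fun e he ↦ G.not_isDiag_of_mem_edgeSet (hedges he)
  have hpH : ∀ e ∈ p.edges, e ∈ H.edgeSet := fun e he ↦ hH ▸ List.mem_append_left _ he
  have hqH : ∀ e ∈ q.edges, e ∈ H.edgeSet := fun e he ↦ hH ▸ List.mem_append_right _ he
  have hcyclic : ¬ H.IsAcyclic := fun h ↦ hpq <| Walk.ext_support <| by
    have := (h.subsingleton_path v w).elim ⟨p.transfer H hpH, hp.transfer hpH⟩
      ⟨q.transfer H hqH, hq.transfer hqH⟩
    simpa using congrArg (fun r ↦ r.val.support) this
  obtain ⟨x, r, hr, hlen⟩ := exists_egirth_eq_length.mpr hcyclic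
  have hr_edges : r.edges ⊆ p.edges ++ q.edges := fun e he ↦ by
    have := hH ▸ r.edges_subset_edgeSet he
    exact this
  calc G.egirth ≤ H.egirth := egirth_anti (by rwa [← edgeSet_subset_edgeSet, hH])
    _ = r.length := hlen
    _ ≤ (p.length + q.length : ℕ) := by
      rw [← r.length_edges, ← p.length_edges, ← q.length_edges, ← List.length_append]
      exact_mod_cast (hr.edges_nodup.subperm hr_edges).length_le

theorem not_adj_of_adj_of_adj (hG : 3 < G.egirth) {a b c : V} (hab : G.Adj a b)
    (hbc : G.Adj b c) : ¬ G.Adj a c := fun hac ↦ by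
  refine hG.not_ge (egirth_le_of_isPath_of_ne (p := .cons hab (.cons hbc .nil))
    (q := .cons hac .nil) ?_ ?_ ?_) <;>
  simp [hab.ne, hbc.ne, hac.ne, Walk.cons_isPath_iff]

theorem eq_of_adj_of_adj (hG : 4 < G.egirth) {a b x y : V} (hab : a ≠ b) (hax : G.Adj a x)
    (hbx : G.Adj b x) (hay : G.Adj a y) (hby : G.Adj b y) : x = y := by
  by_contra hxy
  refine hG.not_ge (egirth_le_of_isPath_of_ne (p := .cons hax (.cons hbx.symm .nil))
    (q := .cons hay (.cons hby.symm .nil)) ?_ ?_ ?_) <;>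
  simp [hab, hax.ne, hay.ne, hbx.ne', hby.ne', hxy, Walk.cons_isPath_iff]

end Girth

section Matching

/-- A matching, encoded as a graph all of whose vertices have at most one neighbor. -/
def IsMatching (M : SimpleGraph V) : Prop :=
  ∀ ⦃x y z⦄, M.Adj x y → M.Adj x z → y = z

variable {M N : SimpleGraph V}

theorem adj_getVert_iff_of_isMatching (hM : IsMatching M) (hN : IsMatching N) {u v : V}
    (w : (M ⊔ N).Walk u v) (hw : ∀ i, i + 2 ≤ w.length → w.getVert i ≠ w.getVert (i + 2)) {i : ℕ}
    (hi : 2 * i < w.length) :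
    M.Adj (w.getVert (2 * i)) (w.getVert (2 * i + 1)) ↔ M.Adj (w.getVert 0) (w.getVert 1) := by
  have halternate {i : ℕ} (hi : i + 2 ≤ w.length) :
      M.Adj (w.getVert (i + 1)) (w.getVert (i + 2)) ↔
        ¬ M.Adj (w.getVert i) (w.getVert (i + 1)) := by
    have h₀ : M.Adj _ _ ∨ N.Adj _ _ := w.adj_getVert_succ (i := i) (by omega)
    have h₁ : M.Adj _ _ ∨ N.Adj _ _ := w.adj_getVert_succ (i := i + 1) (by omega)
    have hMM := fun h : M.Adj (w.getVert i) (w.getVert (i + 1)) ↦ fun h' ↦ hw i hi (hM h.symm h')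
    have hNN := fun h : N.Adj (w.getVert i) (w.getVert (i + 1)) ↦ fun h' ↦ hw i hi (hN h.symm h')
    tauto
  induction i with
  | zero => rfl
  | succ i ih =>
    have ih := ih (by omega)
    have h₁ := halternate (i := 2 * i) (by omega)
    have h₂ := halternate (i := 2 * i + 1) (by omega)
    tauto

theorem getVert_one_eq_of_isMatching (hM : IsMatching M) (hN : IsMatching N) {u : V}
    (w : (M ⊔ N).Walk u u) (hw : ∀ i, i + 2 ≤ w.length → w.getVert i ≠ w.getVert (i + 2)) {k : ℕ}
    (hk : w.length = 2 * k + 1) : w.getVert 1 = w.getVert (2 * k) := by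
  have hfirst : M.Adj _ _ ∨ N.Adj _ _ := w.adj_getVert_succ (i := 0) (by omega)
  have hlast : M.Adj _ _ ∨ N.Adj _ _ := w.adj_getVert_succ (i := 2 * k) (by omega)
  have hiff := adj_getVert_iff_of_isMatching hM hN w hw (i := k) (by omega)
  have hend : w.getVert (2 * k + 1) = w.getVert 0 := by
    rw [← hk, w.getVert_length, w.getVert_zero]
  rw [hend] at hlast hiff
  by_cases h : M.Adj (w.getVert (2 * k)) (w.getVert 0)
  · exact hM (hiff.mp h) h.symm
  · exact hN (hfirst.resolve_left (mt hiff.mpr h)) (hlast.resolve_left h).symm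

theorem even_length_of_isMatching (hM : IsMatching M) (hN : IsMatching N) {u : V}
    (w : (M ⊔ N).Walk u u) : Even w.length := by
  induction hn : w.length using Nat.strong_induction_on generalizing u w with
  | _ n ih =>
    subst hn
    by_contra hodd
    rw [Nat.not_even_iff_odd] at hodd
    -- A closed walk that backtracks somewhere can be shortened by two steps.
    have hback (i : ℕ) (hi : i + 2 ≤ w.length) : w.getVert i ≠ w.getVert (i + 2) := fun h ↦ by
      have hlen : ((w.take i).append ((w.drop (i + 2)).copy h.symm rfl)).length =
          w.length - 2 := by simp; omega
      have heven := ih _ (by omega) _ hlen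
      grind
    obtain ⟨k, hk⟩ := hodd
    have hturn := getVert_one_eq_of_isMatching hM hN w hback hk
    rcases k.eq_zero_or_pos with rfl | hkpos
    · exact (w.adj_getVert_succ (i := 0) (by omega)).ne hturn.symm
    · have hlen : (((w.take (2 * k)).drop 1).copy
          (by rw [Walk.take_getVert, min_eq_right (by omega)]) hturn.symm).length = 2 * k - 1 := by
        simp; omega
      have heven := ih _ (by omega) _ hlen
      grind

theorem exists_set_separating (hM : IsMatching M) (hN : IsMatching N) :
    ∃ S : Set V, (∀ x y, M.Adj x y → (x ∈ S ↔ y ∉ S)) ∧ ∀ x y, N.Adj x y → (x ∈ S ↔ y ∉ S) := by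
  obtain ⟨c⟩ : (M ⊔ N).Colorable 2 :=
    two_colorable_iff_forall_loop_even.mpr fun _ ↦ even_length_of_isMatching hM hN
  have hsep {x y : V} (h : (M ⊔ N).Adj x y) : c x = 0 ↔ c y ≠ 0 := by
    have := c.valid h
    omega
  exact ⟨{v | c v = 0}, fun x y h ↦ hsep (Or.inl h), fun x y h ↦ hsep (Or.inr h)⟩

theorem exists_maximal_isMatching {L : SimpleGraph V} (hM : IsMatching M) (hML : M ≤ L) :
    ∃ N, IsMatching N ∧ M ≤ N ∧ N ≤ L ∧
      ∀ x y, L.Adj x y → ∃ z, N.Adj x z ∨ N.Adj y z := by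
  obtain ⟨N, hMN, hN⟩ := zorn_le_nonempty₀ {N : SimpleGraph V | IsMatching N ∧ N ≤ L}
    (fun C hC hchain P _ ↦ by
      refine ⟨sSup C, ⟨fun x y z hxy hxz ↦ ?_, sSup_le fun N hN ↦ (hC hN).2⟩,
        fun N hN ↦ le_sSup hN⟩
      obtain ⟨A, hA, hxy⟩ := sSup_adj.mp hxy
      obtain ⟨B, hB, hxz⟩ := sSup_adj.mp hxz
      rcases hchain.total hA hB with h | h
      · exact (hC hB).1 (h hxy) hxz
      · exact (hC hA).1 hxy (h hxz)) M ⟨hM, hML⟩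
  refine ⟨N, hN.prop.1, hMN, hN.prop.2, fun x y hxy ↦ ?_⟩
  by_contra! hfree
  refine (N.lt_sup_edge _ _ hxy.ne fun h ↦ (hfree y).1 h).not_ge (hN.le_of_ge
    ⟨fun a b c hab hac ↦ ?_, sup_le hN.prop.2 (L.edge_le_iff.mpr (Or.inr hxy))⟩ le_sup_left)
  have := hN.prop.1 (x := a) (y := b) (z := c)
  simp only [sup_adj, edge_adj] at hab hac
  grind

end Matching

section Valence

/-- The valence of a vertex: its number of neighbors, possibly infinite. -/
noncomputable def valence (G : SimpleGraph V) (v : V) : ℕ∞ :=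
  (G.neighborSet v).encard

theorem neighborSet_map (φ : G ≃g G) (v : V) : G.neighborSet (φ v) = φ '' G.neighborSet v := by
  ext w
  obtain ⟨w, rfl⟩ := φ.surjective w
  simp [φ.map_adj_iff]

theorem valence_map (φ : G ≃g G) (v : V) : valence G (φ v) = valence G v := by
  rw [valence, neighborSet_map, φ.injective.encard_image, valence]

end Valence

section Level

/-- The distance from `v` to the set `B`. It is `0` by convention if `B` is empty. -/
noncomputable def level (G : SimpleGraph V) (B : Set V) (v : V) : ℕ :=
  ⨅ b : B, G.dist b v

/-- The neighbors of `v` that are one step closer to `B`, in the sense of breadth-first search. -/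
def parents (G : SimpleGraph V) (B : Set V) (v : V) : Set V :=
  {p | G.Adj p v ∧ level G B p + 1 = level G B v}

/-- The graph joining any two twins, that is, vertices that share the same single parent: in girth
at least five these are the only vertices that an automorphism fixing all earlier levels can
exchange. -/
def twinGraph (G : SimpleGraph V) (B : Set V) : SimpleGraph V where
  Adj u w := u ≠ w ∧ ∃ p, parents G B u = {p} ∧ parents G B w = {p}
  symm := ⟨fun _ _ ⟨hne, p, hu, hw⟩ ↦ ⟨hne.symm, p, hw, hu⟩⟩

variable {B : Set V} {u v w p : V}

theorem level_le_dist (hv : v ∈ B) : level G B w ≤ G.dist v w :=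
  ciInf_le (OrderBot.bddBelow _) (⟨v, hv⟩ : B)

theorem exists_dist_eq_level (hB : B.Nonempty) (v : V) : ∃ b ∈ B, G.dist b v = level G B v := by
  have := hB.to_subtype
  obtain ⟨⟨b, hb⟩, h⟩ := ciInf_mem fun b : B ↦ G.dist b v
  exact ⟨b, hb, h⟩

theorem level_eq_zero_iff (hG : G.Connected) (hB : B.Nonempty) : level G B v = 0 ↔ v ∈ B := by
  refine ⟨fun h ↦ ?_, fun h ↦ ?_⟩
  · obtain ⟨b, hb, hbv⟩ := exists_dist_eq_level (G := G) hB v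
    rwa [← hG.dist_eq_zero_iff.mp (hbv.trans h)]
  · exact Nat.le_zero.mp ((level_le_dist h).trans_eq G.dist_self)

theorem level_le_succ (hG : G.Connected) (hB : B.Nonempty) (h : G.Adj v w) :
    level G B w ≤ level G B v + 1 := by
  obtain ⟨b, hb, hbv⟩ := exists_dist_eq_level (G := G) hB v
  calc level G B w ≤ G.dist b w := level_le_dist hb
    _ ≤ G.dist b v + G.dist v w := hG.dist_triangle
    _ = level G B v + 1 := by rw [hbv, dist_eq_one_iff_adj.mpr h]

theorem parents_nonempty (hG : G.Connected) (hB : B.Nonempty) (hv : v ∉ B) :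
    (parents G B v).Nonempty := by
  obtain ⟨b, hb, hbv⟩ := exists_dist_eq_level (G := G) hB v
  obtain ⟨w, hw⟩ := hG.exists_walk_length_eq_dist v b
  have := (level_eq_zero_iff hG hB).not.mpr hv
  cases w with
  | nil => exact absurd hb hv
  | @cons _ p _ hvp w =>
    refine ⟨p, hvp.symm, ?_⟩
    have := level_le_succ hG hB hvp.symm
    have : level G B p ≤ w.length := (level_le_dist hb).trans (dist_comm (G := G) ▸ dist_le w)
    rw [Walk.length_cons, dist_comm, hbv] at hw
    omega

theorem level_singleton (r v : V) : level G {r} v = G.dist r v :=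
  ciInf_unique

theorem level_singleton_eq_one_iff {r : V} : level G {r} v = 1 ↔ G.Adj r v := by
  rw [level_singleton, dist_eq_one_iff_adj]

theorem level_singleton_eq_zero_iff (hG : G.Connected) {r : V} : level G {r} v = 0 ↔ v = r :=
  level_eq_zero_iff hG (Set.singleton_nonempty r)

theorem dist_map (hG : G.Connected) (φ : G ≃g G) (v w : V) : G.dist (φ v) (φ w) = G.dist v w := by
  have hle (ψ : G ≃g G) (v w : V) : G.dist (ψ v) (ψ w) ≤ G.dist v w := by
    obtain ⟨p, hp⟩ := hG.exists_walk_length_eq_dist v w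
    exact hp ▸ (p.length_map ψ.toHom) ▸ dist_le (p.map ψ.toHom)
  refine (hle φ v w).antisymm ?_
  simpa using hle φ.symm (φ v) (φ w)

theorem level_map (hG : G.Connected) {φ : G ≃g G} (hφ : ∀ v, φ v ∈ B ↔ v ∈ B) (v : V) :
    level G B (φ v) = level G B v :=
  ((φ.toEquiv.subtypeEquiv fun v ↦ (hφ v).symm).iInf_congr fun b ↦ dist_map hG φ b v).symm

theorem parents_map (hG : G.Connected) {φ : G ≃g G} (hφ : ∀ v, φ v ∈ B ↔ v ∈ B) (v : V) :
    parents G B (φ v) = φ '' parents G B v := by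
  ext p
  obtain ⟨p, rfl⟩ := φ.surjective p
  simp [parents, level_map hG hφ, φ.map_adj_iff]

theorem mem_iff_of_fixed {φ : G ≃g G} (hφ : ∀ v ∈ B, φ v = v) (v : V) : φ v ∈ B ↔ v ∈ B :=
  ⟨fun h ↦ φ.injective (hφ _ h) ▸ h, fun h ↦ (hφ v h).symm ▸ h⟩

theorem fixed_or_twin (hG : G.Connected) (hB : B.Nonempty) (hg : 4 < G.egirth) {φ : G ≃g G}
    (hφ : ∀ v, φ v ∈ B ↔ v ∈ B) (hu : u ∉ B) (hfix : ∀ p ∈ parents G B u, φ p = p) :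
    φ u = u ∨ (twinGraph G B).Adj u (φ u) := by
  refine or_iff_not_imp_left.mpr fun hne ↦ ⟨Ne.symm hne, ?_⟩
  obtain ⟨p, hp⟩ := parents_nonempty hG hB hu
  have hadj {q : V} (hq : q ∈ parents G B u) : G.Adj (φ u) q := by
    simpa only [hfix q hq] using φ.map_adj_iff.mpr hq.1.symm
  have hpu : parents G B u = {p} := Set.eq_singleton_iff_unique_mem.mpr ⟨hp, fun q hq ↦
    eq_of_adj_of_adj hg hne (hadj hq) hq.1.symm (hadj hp) hp.1.symm⟩
  exact ⟨p, hpu, by rw [parents_map hG hφ, hpu, Set.image_singleton, hfix p hp]⟩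

theorem eq_self_of_not_twin (hG : G.Connected) (hB : B.Nonempty) (hg : 4 < G.egirth)
    {φ : G ≃g G} (hφ : ∀ v ∈ B, φ v = v) (htwin : ∀ v, ¬ (twinGraph G B).Adj v (φ v)) (v : V) :
    φ v = v := by
  induction hn : level G B v using Nat.strong_induction_on generalizing v with
  | _ n ih =>
    by_cases hv : v ∈ B
    · exact hφ v hv
    · refine (fixed_or_twin hG hB hg (mem_iff_of_fixed hφ) hv fun p hp ↦ ?_).resolve_right (htwin v)
      exact ih _ (hn ▸ hp.2 ▸ Nat.lt_succ_self _) p rfl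

theorem level_eq_of_twin (h : (twinGraph G B).Adj u w) : level G B u = level G B w := by
  obtain ⟨-, p, hu, hw⟩ := h
  have hpu : p ∈ parents G B u := hu ▸ rfl
  have hpw : p ∈ parents G B w := hw ▸ rfl
  exact hpu.2.symm.trans hpw.2

end Level

section TwinMatching

variable {B : Set V}

theorem encard_neighborSet_diff_singleton_le {v p : V} {n : ℕ} (hv : valence G v ≤ (n + 1 : ℕ))
    (hp : G.Adj v p) : (G.neighborSet v \ {p}).encard ≤ n := by
  rw [valence, ← Set.encard_sdiff_singleton_add_one ((G.mem_neighborSet v p).mpr hp)] at hv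
  exact_mod_cast (ENat.add_le_add_iff_right ENat.one_ne_top).mp hv

theorem encard_children_le_two_of_notMem (hG : G.Connected) (hB : B.Nonempty)
    (h3 : ∀ v, valence G v ≤ 3) {p : V} (hp : p ∉ B) : {v | p ∈ parents G B v}.encard ≤ 2 := by
  obtain ⟨q, hq⟩ := parents_nonempty hG hB hp
  refine (Set.encard_le_encard fun v hv ↦ ?_).trans
    (encard_neighborSet_diff_singleton_le (n := 2) (h3 p) hq.1.symm)
  refine ⟨hv.1, ?_⟩
  rintro rfl
  have := hv.2
  have := hq.2
  omega

theorem children_subset (hG : G.Connected) (hB : B.Nonempty) {p : V} :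
    {v | p ∈ parents G B v} ⊆ G.neighborSet p \ B := by
  refine fun v hv ↦ ⟨hv.1, fun hvB ↦ ?_⟩
  have := hv.2
  rw [(level_eq_zero_iff hG hB).mpr hvB] at this
  omega

theorem isMatching_twinGraph (hG : G.Connected) (hB : B.Nonempty) (h3 : ∀ v, valence G v ≤ 3)
    (hBout : ∀ b ∈ B, (G.neighborSet b \ B).encard ≤ 2) : IsMatching (twinGraph G B) := by
  rintro u w x ⟨huw, p, hu, hw⟩ ⟨hux, q, hu', hx⟩
  obtain rfl : p = q := Set.singleton_injective (hu.symm.trans hu')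
  have hle : {v | p ∈ parents G B v}.encard ≤ 2 := by
    by_cases hp : p ∈ B
    · exact (Set.encard_le_encard (children_subset hG hB)).trans (hBout p hp)
    · exact encard_children_le_two_of_notMem hG hB h3 hp
  have hchildren := eq_pair_of_encard_le_two hle (a := u) (b := w) (by simp [hu]) (by simp [hw]) huw
  have hxmem : x ∈ {v | p ∈ parents G B v} := by simp [hx]
  rw [hchildren] at hxmem
  exact (hxmem.resolve_left hux.symm).symm

theorem valence_ne_two_of_twin (hG : G.Connected) (hB : B.Nonempty) {u w p : V}
    (h : (twinGraph G B).Adj u w) (hp : p ∈ parents G B u) (hpB : p ∉ B) : valence G p ≠ 2 := by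
  intro hp2
  obtain ⟨huw, q, hu, hw⟩ := h
  obtain rfl : p = q := by simpa [hu] using hp
  obtain ⟨q, hq⟩ := parents_nonempty hG hB hpB
  have hwp : p ∈ parents G B w := hw ▸ rfl
  have hN := eq_pair_of_encard_le_two hp2.le (a := u) (b := w) hp.1 hwp.1 huw
  have hqN : q ∈ G.neighborSet p := hq.1.symm
  rw [hN] at hqN
  have := hp.2
  have := hq.2
  have := hwp.2
  rcases hqN with rfl | rfl <;> omega

end TwinMatching

section AdjacentValenceTwo

theorem exists_valence_two_boundary (hG : G.Connected) {x y z : V} (hx : valence G x = 2)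
    (hy : valence G y = 2) (hxy : G.Adj x y) (hz : valence G z ≠ 2) :
    ∃ r s t, G.Adj r s ∧ G.Adj r t ∧ valence G r = 2 ∧ valence G s ≠ 2 ∧ valence G t = 2 := by
  by_contra! hcon
  suffices ∀ v, G.Reachable x v → valence G v = 2 ∧ ∃ w, G.Adj v w ∧ valence G w = 2 from
    hz (this z (hG x z)).1
  intro v hv
  rw [reachable_iff_reflTransGen] at hv
  induction hv with
  | refl => exact ⟨hx, y, hxy, hy⟩
  | @tail v w _ hvw ih =>
    obtain ⟨hv, u, hvu, hu⟩ := ih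
    refine ⟨?_, v, hvw.symm, hv⟩
    by_contra hw
    exact hcon v w u hvw hvu hv hw hu

/-- The graph joining adjacent vertices of valence two at equal distance from `B`. If the ends of
these edges have different colors, none of them can be confused with an edge at the root. -/
def valenceTwoPairs (G : SimpleGraph V) (B : Set V) : SimpleGraph V where
  Adj x y := G.Adj x y ∧ level G B x = level G B y ∧ valence G x = 2 ∧ valence G y = 2
  symm := ⟨fun _ _ ⟨h, hl, hx, hy⟩ ↦ ⟨h.symm, hl.symm, hy, hx⟩⟩

theorem isMatching_valenceTwoPairs_singleton (hG : G.Connected) (r : V) :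
    IsMatching (valenceTwoPairs G {r}) := by
  rintro x y z ⟨hxy, hly, hx, -⟩ ⟨hxz, hlz, -, -⟩
  have hxr : x ≠ r := by
    rintro rfl
    rw [(level_singleton_eq_zero_iff hG).mpr rfl, eq_comm, level_singleton_eq_zero_iff hG] at hly
    exact hxy.ne hly.symm
  obtain ⟨p, hp⟩ := parents_nonempty hG (Set.singleton_nonempty r) hxr
  have hpy : p ≠ y := by
    rintro rfl
    have := hp.2
    omega
  have hz : z ∈ G.neighborSet x := hxz
  rw [eq_pair_of_encard_le_two hx.le (a := p) (b := y) hp.1.symm hxy hpy] at hz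
  rcases hz with rfl | rfl
  · have := hp.2
    omega
  · rfl

/-- The vertices at distance at most one from `r`, and those vertices of `S₀` that have a twin: the
distinguishing set in the case of adjacent vertices `r` and `t` of valence two. -/
def rootedSet (G : SimpleGraph V) (r : V) (S₀ : Set V) : Set V :=
  {v | level G {r} v ≤ 1 ∨ (∃ w, (twinGraph G {r}).Adj v w) ∧ v ∈ S₀}

theorem isMatching_twinGraph_singleton (hG : G.Connected) (h3 : ∀ v, valence G v ≤ 3) {r : V}
    (hr : valence G r = 2) : IsMatching (twinGraph G {r}) := by
  refine isMatching_twinGraph hG (Set.singleton_nonempty r) h3 fun b hb ↦ ?_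
  rw [Set.mem_singleton_iff.mp hb, ← hr]
  exact Set.encard_le_encard Set.sdiff_subset

variable {r s t : V} {S₀ : Set V}

theorem notMem_rootedSet_of_adj (hG : G.Connected) (hg : 3 < G.egirth) (hrt : G.Adj r t)
    (ht : valence G t = 2) {q : V} (htq : G.Adj t q) (hqr : q ≠ r) : q ∉ rootedSet G r S₀ := by
  have hq0 := (level_singleton_eq_zero_iff hG).not.mpr hqr
  have hq1 : level G {r} q ≠ 1 := by
    rw [Ne, level_singleton_eq_one_iff]
    exact not_adj_of_adj_of_adj hg hrt htq
  have ht1 := level_singleton_eq_one_iff.mpr hrt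
  have hq2 := level_le_succ hG (Set.singleton_nonempty r) htq
  rintro (hq | ⟨⟨w, hw⟩, -⟩)
  · omega
  · exact valence_ne_two_of_twin hG (Set.singleton_nonempty r) hw ⟨htq, by omega⟩ hrt.ne' ht

theorem eq_root_of_mem_rootedSet (hG : G.Connected) (hg : 3 < G.egirth)
    (hrs : G.Adj r s) (hrt : G.Adj r t) (hr : valence G r = 2) (hs : valence G s ≠ 2)
    (ht : valence G t = 2) (hS₀ : ∀ x y, (valenceTwoPairs G {r}).Adj x y → (x ∈ S₀ ↔ y ∉ S₀))
    {q q₁ q₂ : V} (hq₂q : G.Adj q q₂) (hqq₁ : G.Adj q q₁) (hq : valence G q = 2)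
    (hq₂ : valence G q₂ ≠ 2) (hq₁ : valence G q₁ = 2) (hqS : q ∈ rootedSet G r S₀)
    (hq₁S : q₁ ∈ rootedSet G r S₀) (hq₂S : q₂ ∈ rootedSet G r S₀) : q = r := by
  have hB := Set.singleton_nonempty r
  by_contra hqr
  have hq0 := (level_singleton_eq_zero_iff hG).not.mpr hqr
  have hq1 : level G {r} q ≠ 1 := by
    rw [Ne, level_singleton_eq_one_iff]
    intro hrq
    have hNr := eq_pair_of_encard_le_two hr.le (a := s) (b := t) hrs hrt fun h ↦ hs (h ▸ ht)
    have hqN : q ∈ G.neighborSet r := hrq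
    rw [hNr] at hqN
    obtain rfl : q = t := hqN.resolve_left fun h ↦ hs (h ▸ hq)
    exact notMem_rootedSet_of_adj hG hg hrt hq hq₂q (fun h ↦ hq₂ (h ▸ hr)) hq₂S
  have hlow := level_le_succ hG hB hqq₁
  have hhigh := level_le_succ hG hB hqq₁.symm
  have hq₁r : q₁ ≠ r := by
    rw [Ne, ← level_singleton_eq_zero_iff hG]
    omega
  obtain ⟨⟨w, hw⟩, hqS₀⟩ := hqS.resolve_left (by omega)
  have hnot_parent : level G {r} q₁ + 1 ≠ level G {r} q := fun h ↦
    valence_ne_two_of_twin hG hB hw ⟨hqq₁.symm, h⟩ hq₁r hq₁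
  obtain ⟨⟨w₁, hw₁⟩, hq₁S₀⟩ := hq₁S.resolve_left (by omega)
  have hnot_child : level G {r} q + 1 ≠ level G {r} q₁ := fun h ↦
    valence_ne_two_of_twin hG hB hw₁ ⟨hqq₁, h⟩ hqr hq
  exact (hS₀ q q₁ ⟨hqq₁, by omega, hq, hq₁⟩).mp hqS₀ hq₁S₀

theorem isDistinguishingSet_rootedSet (hG : G.Connected) (hg : 4 < G.egirth)
    (hrs : G.Adj r s) (hrt : G.Adj r t) (hr : valence G r = 2) (hs : valence G s ≠ 2)
    (ht : valence G t = 2) (htwin : ∀ x y, (twinGraph G {r}).Adj x y → (x ∈ S₀ ↔ y ∉ S₀))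
    (hpair : ∀ x y, (valenceTwoPairs G {r}).Adj x y → (x ∈ S₀ ↔ y ∉ S₀)) :
    IsDistinguishingSet G (rootedSet G r S₀) := by
  intro φ hφ
  have hball {v : V} (hv : level G {r} v ≤ 1) : φ v ∈ rootedSet G r S₀ := (hφ v).mpr (Or.inl hv)
  have hφr : φ r = r := by
    refine eq_root_of_mem_rootedSet hG (lt_trans (by norm_num) hg) hrs hrt hr hs ht hpair
      (φ.map_adj_iff.mpr hrs) (φ.map_adj_iff.mpr hrt) ?_ ?_ ?_ (hball ?_) (hball ?_) (hball ?_)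
    all_goals simp_all [valence_map, level_singleton, dist_eq_one_iff_adj.mpr]
  refine eq_self_of_not_twin hG (Set.singleton_nonempty r) hg (by simpa using hφr) fun v hv ↦ ?_
  rcases Nat.lt_or_ge 1 (level G {r} v) with h1 | h1
  · have hmem {x y : V} (hxy : (twinGraph G {r}).Adj x y) (hx : 1 < level G {r} x) :
        x ∈ rootedSet G r S₀ ↔ x ∈ S₀ := by
      simp only [rootedSet, Set.mem_ofPred_eq, hx.not_ge, false_or, and_iff_right_iff_imp]
      exact fun _ ↦ ⟨y, hxy⟩
    have := htwin _ _ hv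
    rw [← hmem hv h1, ← hmem hv.symm (level_eq_of_twin hv ▸ h1), hφ v] at this
    tauto
  · have hNr := eq_pair_of_encard_le_two hr.le (a := s) (b := t) hrs hrt fun h ↦ hs (h ▸ ht)
    have hmem {x : V} (hx : level G {r} x ≤ 1) (hxr : x ≠ r) : x = s ∨ x = t := by
      have h0 := (level_singleton_eq_zero_iff hG).not.mpr hxr
      have hxN : x ∈ G.neighborSet r := level_singleton_eq_one_iff.mp (by omega)
      rwa [hNr] at hxN
    have hvr : v ≠ r := fun h ↦ hv.ne (by rw [h, hφr])
    have hφvr : φ v ≠ r := fun h ↦ hvr (φ.injective (h.trans hφr.symm))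
    have hval := valence_map φ v
    have := hv.ne
    rcases hmem h1 hvr with rfl | rfl <;>
    rcases hmem (level_eq_of_twin hv ▸ h1) hφvr with h | h <;>
    simp_all

theorem exists_isDistinguishingSet_of_adj_valence_two (hG : G.Connected)
    (h3 : ∀ v, valence G v ≤ 3) (hg : 4 < G.egirth) {x y z : V} (hxy : G.Adj x y)
    (hx : valence G x = 2) (hy : valence G y = 2) (hz : valence G z ≠ 2) :
    ∃ S, IsDistinguishingSet G S := by
  obtain ⟨r, s, t, hrs, hrt, hr, hs, ht⟩ := exists_valence_two_boundary hG hx hy hxy hz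
  obtain ⟨S₀, htwin, hpair⟩ := exists_set_separating (isMatching_twinGraph_singleton hG h3 hr)
    (isMatching_valenceTwoPairs_singleton hG r)
  exact ⟨_, isDistinguishingSet_rootedSet hG hg hrs hrt hr hs ht htwin hpair⟩

end AdjacentValenceTwo

section IsolatedValenceTwo

/-- The vertices from which `v` is reached by two steps away from `B` through a vertex of
valence two. -/
def valenceTwoGrandparents (G : SimpleGraph V) (B : Set V) (v : V) : Set V :=
  {p | ∃ u ∈ parents G B v, valence G u = 2 ∧ p ∈ parents G B u}

/-- The graph joining any two vertices whose grandparents through vertices of valence two are the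
same, one of them being outside `B`. If no two vertices of valence
two are adjacent, exchanging two twins of valence two forces the exchange of such a pair, or of two
twins, of valence three. -/
def cousinGraph (G : SimpleGraph V) (B : Set V) : SimpleGraph V where
  Adj x y := x ≠ y ∧ valenceTwoGrandparents G B x = valenceTwoGrandparents G B y ∧
    ∃ p ∈ valenceTwoGrandparents G B x, p ∉ B
  symm := ⟨fun _ _ ⟨hne, h, hp⟩ ↦ ⟨hne.symm, h.symm, h ▸ hp⟩⟩

variable {B : Set V}

theorem isMatching_cousinGraph (hG : G.Connected) (hB : B.Nonempty)
    (h3 : ∀ v, valence G v ≤ 3) : IsMatching (cousinGraph G B) := by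
  rintro x y z ⟨hxy, hgy, p, hp, hpB⟩ ⟨hxz, hgz, -⟩
  by_contra hyz
  have huniq {x y u : V} (hu : valence G u = 2) (hpu : p ∈ parents G B u)
      (hux : u ∈ parents G B x) (huy : u ∈ parents G B y) : x = y := by
    have hlpu := hpu.2
    have hlux := hux.2
    have hluy := huy.2
    have hpx : p ≠ x := by rintro rfl; omega
    have hy : y ∈ G.neighborSet u := huy.1
    rw [eq_pair_of_encard_le_two hu.le (a := p) (b := x) hpu.1.symm hux.1 hpx] at hy
    rcases hy with rfl | rfl
    · omega
    · rfl
  obtain ⟨u, hux, hu, hpu⟩ := hp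
  obtain ⟨v, hvy, hv, hpv⟩ : p ∈ valenceTwoGrandparents G B y := hgy ▸ ⟨u, hux, hu, hpu⟩
  obtain ⟨w, hwz, -, hpw⟩ : p ∈ valenceTwoGrandparents G B z := hgz ▸ ⟨u, hux, hu, hpu⟩
  have huv : u ≠ v := fun h ↦ hxy (huniq hu hpu hux (h ▸ hvy))
  have hwN : w ∈ {v | p ∈ parents G B v} := hpw
  rw [eq_pair_of_encard_le_two (encard_children_le_two_of_notMem hG hB h3 hpB) hpu hpv huv] at hwN
  rcases hwN with rfl | rfl
  · exact hxz (huniq hu hpu hux hwz)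
  · exact hyz (huniq hv hpv hvy hwz)

theorem valenceTwoGrandparents_map (hG : G.Connected) {φ : G ≃g G} (hφ : ∀ v, φ v ∈ B ↔ v ∈ B)
    (v : V) : valenceTwoGrandparents G B (φ v) = φ '' valenceTwoGrandparents G B v := by
  ext p
  simp only [valenceTwoGrandparents, parents_map hG hφ, Set.exists_mem_image, valence_map,
    Set.mem_ofPred_eq]
  constructor
  · rintro ⟨u, huv, hu, p, hp, rfl⟩
    exact ⟨p, ⟨u, huv, hu, hp⟩, rfl⟩
  · rintro ⟨p, ⟨u, huv, hu, hp⟩, rfl⟩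
    exact ⟨u, huv, hu, p, hp, rfl⟩

theorem level_eq_or_cousin_of_twin (hG : G.Connected) (hB : B.Nonempty) (hg : 4 < G.egirth)
    {φ : G ≃g G} (hφ : ∀ v, φ v ∈ B ↔ v ∈ B) {u x : V}
    (hfix : ∀ v, level G B v < level G B u → φ v = v) (hu : valence G u = 2)
    (huB : ∀ p ∈ parents G B u, p ∉ B)
    (htwin : (twinGraph G B).Adj u (φ u)) (hux : G.Adj u x) (hx : x ∉ parents G B u) :
    φ x ≠ x ∧ (level G B x = level G B u ∨ (cousinGraph G B).Adj x (φ x)) := by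
  obtain ⟨hne, p, hpu, hpφu⟩ := htwin
  have hp : p ∈ parents G B u := hpu ▸ rfl
  have hpφ : p ∈ parents G B (φ u) := hpφu ▸ rfl
  have hφux := φ.map_adj_iff.mpr hux
  have hφx : φ x ≠ x := fun h ↦ hx <| by
    rw [h] at hφux
    rwa [← eq_of_adj_of_adj hg hne hp.1.symm hpφ.1.symm hux hφux]
  refine ⟨hφx, or_iff_not_imp_left.mpr fun hxu ↦ ?_⟩
  have hlux := level_le_succ hG hB hux
  have hlxu := level_le_succ hG hB hux.symm
  have hx' : level G B x + 1 ≠ level G B u := fun h ↦ hx ⟨hux.symm, h⟩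
  refine ⟨hφx.symm, ?_, p, ⟨u, ⟨hux, by omega⟩, hu, hp⟩, huB p hp⟩
  rw [valenceTwoGrandparents_map hG hφ]
  refine (Set.EqOn.image_eq_self fun q hq ↦ hfix q ?_).symm
  obtain ⟨w, hw, -, hq⟩ := hq
  have := hw.2
  have := hq.2
  omega

theorem fixed_of_level_le_one (hG : G.Connected) {r s : V} (hr : valence G r = 2)
    (hrs : G.Adj r s) {φ : G ≃g G} (hφr : φ r = r) (hφs : φ s = s) {v : V}
    (hv : level G {r} v ≤ 1) : φ v = v := by
  obtain rfl | hvr := eq_or_ne v r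
  · exact hφr
  obtain rfl | hvs := eq_or_ne v s
  · exact hφs
  have h0 := (level_singleton_eq_zero_iff hG).not.mpr hvr
  have hrv : G.Adj r v := level_singleton_eq_one_iff.mp (by omega)
  have hφv : φ v ∈ G.neighborSet r := by
    rw [← hφr]
    exact φ.map_adj_iff.mpr hrv
  rw [eq_pair_of_encard_le_two hr.le (a := s) (b := v) hrs hrv hvs.symm] at hφv
  exact hφv.resolve_left fun h ↦ hvs (φ.injective (h.trans hφs.symm))

theorem eq_self_of_not_twin_of_not_cousin (hG : G.Connected) (h2 : ∀ v, 2 ≤ valence G v)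
    (hg : 4 < G.egirth) (hiso : ∀ x y, G.Adj x y → valence G x = 2 → valence G y ≠ 2) {r : V}
    {φ : G ≃g G} (hlow : ∀ v, level G {r} v ≤ 1 → φ v = v)
    (htwin : ∀ v, 2 ≤ level G {r} v → valence G v ≠ 2 → ¬ (twinGraph G {r}).Adj v (φ v))
    (hcousin : ∀ v, 2 ≤ level G {r} v → valence G v ≠ 2 → ¬ (cousinGraph G {r}).Adj v (φ v))
    (v : V) : φ v = v := by
  have hB := Set.singleton_nonempty r
  have hφ : ∀ v, φ v ∈ ({r} : Set V) ↔ v ∈ ({r} : Set V) := mem_iff_of_fixed fun v hv ↦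
    hlow v (((level_eq_zero_iff hG hB).mpr hv).trans_le zero_le_one)
  induction hn : level G {r} v using Nat.strong_induction_on generalizing v with
  | _ n ih =>
    subst hn
    have hfix : ∀ w, level G {r} w < level G {r} v → φ w = w := fun w hw ↦ ih _ hw w rfl
    rcases Nat.lt_or_ge 1 (level G {r} v) with hl | hl
    swap
    · exact hlow v hl
    have hnotB {w : V} (hw : 1 ≤ level G {r} w) : w ∉ ({r} : Set V) := by
      rw [← level_eq_zero_iff hG hB]
      omega
    have hsame {w : V} (hw : level G {r} w = level G {r} v) :
        φ w = w ∨ (twinGraph G {r}).Adj w (φ w) :=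
      fixed_or_twin hG hB hg hφ (hnotB (by omega)) fun p hp ↦ hfix p (by have := hp.2; omega)
    refine (hsame rfl).resolve_right fun h ↦ ?_
    have hv : valence G v = 2 := by_contra fun hv ↦ htwin v hl hv h
    obtain ⟨-, p, hp, -⟩ := id h
    obtain ⟨x, hvx, hxp⟩ := Set.exists_ne_of_one_lt_encard (lt_of_lt_of_le (by norm_num) (h2 v)) p
    replace hvx : G.Adj v x := hvx
    have hxval := hiso v x hvx hv
    have hxpar : x ∉ parents G {r} v := by simpa [hp] using hxp
    have hlx : level G {r} v ≤ level G {r} x := by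
      have := level_le_succ hG hB (hvx.symm)
      have : level G {r} x + 1 ≠ level G {r} v := fun h ↦ hxpar ⟨hvx.symm, h⟩
      omega
    obtain ⟨hφx, hx | hx⟩ := level_eq_or_cousin_of_twin hG hB hg hφ hfix hv
      (fun q hq ↦ hnotB (by have := hq.2; omega)) h hvx hxpar
    · exact htwin x (hl.trans_eq hx.symm) hxval ((hsame hx).resolve_left hφx)
    · exact hcousin x (hl.trans_le hlx) hxval hx

theorem isDistinguishingSet_of_isolated_valence_two (hG : G.Connected)
    (h2 : ∀ v, 2 ≤ valence G v) (hg : 4 < G.egirth)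
    (hiso : ∀ x y, G.Adj x y → valence G x = 2 → valence G y ≠ 2) {r s : V}
    (hr : valence G r = 2) (hrs : G.Adj r s) {S₀ : Set V}
    (htwin : ∀ x y, (twinGraph G {r}).Adj x y → (x ∈ S₀ ↔ y ∉ S₀))
    (hcousin : ∀ x y, (cousinGraph G {r}).Adj x y → (x ∈ S₀ ↔ y ∉ S₀)) :
    IsDistinguishingSet G {v | v = r ∨ v = s ∨ v ∈ S₀ ∧ valence G v ≠ 2 ∧ 2 ≤ level G {r} v} := by
  intro φ hφ
  simp only [Set.mem_ofPred_eq] at hφ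
  have hs := hiso r s hrs hr
  have hφr : φ r = r := by
    rcases (hφ r).mpr (Or.inl rfl) with h | h | h
    · exact h
    · exact absurd (valence_map φ r ▸ hr) (h ▸ hs)
    · exact absurd (valence_map φ r ▸ hr) h.2.1
  have hlφ := level_map hG (mem_iff_of_fixed (B := {r}) (φ := φ) (by simpa using hφr))
  have hls := level_singleton_eq_one_iff.mpr hrs
  have hφs : φ s = s := by
    rcases (hφ s).mpr (Or.inr (Or.inl rfl)) with h | h | h
    · exact absurd (φ.injective (h.trans hφr.symm)) hrs.ne'
    · exact h
    · exact absurd h.2.2 (by rw [hlφ]; omega)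
  have hmem {v : V} (hl : 2 ≤ level G {r} v) (hv : valence G v ≠ 2) : φ v ∈ S₀ ↔ v ∈ S₀ := by
    have hout {w : V} (hl : 2 ≤ level G {r} w) (hw : valence G w ≠ 2) : w ≠ r ∧ w ≠ s :=
      ⟨by rintro rfl; exact hw hr, by rintro rfl; omega⟩
    have hφv := hout (w := φ v) (by rwa [hlφ]) (by rwa [valence_map])
    simpa [hout hl hv, hφv, hv, hl, valence_map, hlφ] using hφ v
  refine eq_self_of_not_twin_of_not_cousin (r := r) hG h2 hg hiso (fun v hv ↦ ?_)
    (fun v hl hv h ↦ ?_) (fun v hl hv h ↦ ?_)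
  · exact fixed_of_level_le_one hG hr hrs hφr hφs hv
  · have := htwin _ _ h
    have := hmem hl hv
    tauto
  · have := hcousin _ _ h
    have := hmem hl hv
    tauto

theorem exists_isDistinguishingSet_of_isolated_valence_two (hG : G.Connected)
    (h2 : ∀ v, 2 ≤ valence G v) (h3 : ∀ v, valence G v ≤ 3) (hg : 4 < G.egirth)
    (hiso : ∀ x y, G.Adj x y → valence G x = 2 → valence G y ≠ 2) {r : V}
    (hr : valence G r = 2) : ∃ S, IsDistinguishingSet G S := by
  obtain ⟨s, hrs, -⟩ := Set.exists_ne_of_one_lt_encard (lt_of_lt_of_le (by norm_num) (h2 r)) r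
  obtain ⟨S₀, htwin, hcousin⟩ := exists_set_separating (isMatching_twinGraph_singleton hG h3 hr)
    (isMatching_cousinGraph hG (Set.singleton_nonempty r) h3)
  exact ⟨_, isDistinguishingSet_of_isolated_valence_two hG h2 hg hiso hr hrs htwin hcousin⟩

end IsolatedValenceTwo

section GirthCycle

/-- A shortest cycle of `G`, given by its consecutive vertices; its length is `g`. -/
structure IsGirthCycle (G : SimpleGraph V) (g : ℕ) (c : ZMod g → V) : Prop where
  injective : Function.Injective c
  adj_succ (i : ZMod g) : G.Adj (c i) (c (i + 1))
  egirth_eq : G.egirth = g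

variable {g : ℕ} {c : ZMod g → V}

theorem exists_isGirthCycle (hG : ¬ G.IsAcyclic) : ∃ g c, IsGirthCycle G g c := by
  obtain ⟨a, w, hw, hlen⟩ := exists_egirth_eq_length.mpr hG
  have h3 := hw.three_le_length
  have : NeZero w.length := ⟨by omega⟩
  refine ⟨w.length, fun i ↦ w.getVert i.val, fun i j hij ↦ ?_, fun i ↦ ?_, hlen⟩
  · have hi := i.val_lt
    have hj := j.val_lt
    exact ZMod.val_injective _ (hw.getVert_injOn' (by simp; omega) (by simp; omega) hij)
  · have hi := i.val_lt
    have h1 : (1 : ZMod w.length).val = 1 := ZMod.val_one'' (by omega)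
    have hadj := w.adj_getVert_succ hi
    rw [ZMod.val_add, h1]
    obtain hlt | heq : i.val + 1 < w.length ∨ i.val + 1 = w.length := by omega
    · rwa [Nat.mod_eq_of_lt hlt]
    · rw [heq, w.getVert_length] at hadj
      rwa [heq, Nat.mod_self, w.getVert_zero]

theorem val_sub_add_val_sub [NeZero g] {i j : ZMod g} (hij : i ≠ j) :
    (i - j).val + (j - i).val = g := by
  have : NeZero (i - j) := ⟨sub_ne_zero.mpr hij⟩
  rw [← neg_sub i j, ZMod.val_neg_of_ne_zero]
  have := (i - j).val_lt
  omega

theorem zmod_numerals_pairwise_ne (hg : 6 ≤ g) :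
    [(0 : ZMod g), 1, 2, 3, 4, 5].Pairwise (· ≠ ·) := by
  have h : ((List.range 6).map (Nat.cast : ℕ → ZMod g)).Nodup := by
    refine List.nodup_range.map_on fun m hm n hn hmn ↦ ?_
    rw [List.mem_range] at hm hn
    rwa [ZMod.natCast_eq_natCast_iff', Nat.mod_eq_of_lt (by omega),
      Nat.mod_eq_of_lt (by omega)] at hmn
  simpa only [List.Nodup, List.range_succ, List.range_zero, List.nil_append, List.cons_append,
    List.map_cons, List.map_nil, Nat.cast_zero, Nat.cast_one, Nat.cast_ofNat] using h

namespace IsGirthCycle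

variable (hc : IsGirthCycle G g c)
include hc

theorem adj_pred (i : ZMod g) : G.Adj (c i) (c (i - 1)) := by
  simpa using (hc.adj_succ (i - 1)).symm

theorem exists_arc (i : ZMod g) {k : ℕ} (hk : k < g) :
    ∃ p : G.Walk (c i) (c (i + k)), p.IsPath ∧ p.length = k ∧
      ∀ v ∈ p.support, ∃ m ≤ k, v = c (i + (m : ℕ)) := by
  induction k with
  | zero => exact ⟨.copy .nil rfl (by simp), by simp, by simp, fun v hv ↦ ⟨0, by simpa using hv⟩⟩
  | succ k ih =>
    obtain ⟨p, hp, hlen, hsupp⟩ := ih (by omega)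
    have hadj : G.Adj (c (i + k)) (c (i + (k + 1 : ℕ))) := by
      simpa [add_assoc] using hc.adj_succ (i + k)
    refine ⟨p.concat hadj, hp.concat (fun h ↦ ?_) hadj, by simp [hlen], fun v hv ↦ ?_⟩
    · obtain ⟨m, hm, h⟩ := hsupp _ h
      have h := add_left_cancel (hc.injective h)
      rw [ZMod.natCast_eq_natCast_iff', Nat.mod_eq_of_lt hk, Nat.mod_eq_of_lt (by omega)] at h
      omega
    · rw [Walk.support_concat, List.mem_append, List.mem_singleton] at hv
      obtain hv | rfl := hv
      · obtain ⟨m, hm, h⟩ := hsupp v hv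
        exact ⟨m, by omega, h⟩
      · exact ⟨k + 1, le_rfl, rfl⟩

theorem val_sub_le_length [NeZero g] {i j : ZMod g} {q : G.Walk (c i) (c j)} (hq : q.IsPath)
    (hne : q.length ≠ (i - j).val ∨ ∃ v ∈ q.support, v ∉ Set.range c) :
    (j - i).val ≤ q.length := by
  obtain rfl | hij := eq_or_ne i j
  · simp
  obtain ⟨p, hp, hlen, hsupp⟩ := hc.exists_arc j (ZMod.val_lt (i - j))
  have hend : c (j + ((i - j).val : ℕ)) = c i := by simp
  have hpq : q ≠ (p.copy rfl hend).reverse := by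
    rintro rfl
    rcases hne with h | ⟨v, hv, hout⟩
    · simp [hlen] at h
    · obtain ⟨m, -, rfl⟩ := hsupp v (by simpa using hv)
      exact hout ⟨_, rfl⟩
  have hle := egirth_le_of_isPath_of_ne hq (by simpa using hp) hpq
  have hle : g ≤ q.length + (i - j).val := by
    rw [hc.egirth_eq, Nat.cast_le] at hle
    simpa [hlen] using hle
  have := val_sub_add_val_sub hij
  omega

theorem eq_succ_or_eq_succ_of_adj [NeZero g] {i j : ZMod g} (h : G.Adj (c i) (c j)) :
    j = i + 1 ∨ i = j + 1 := by
  have hij : i ≠ j := fun hij ↦ h.ne (hij ▸ rfl)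
  have hg : 1 < g := by
    by_contra! hg
    have := i.val_lt
    have := j.val_lt
    exact hij (ZMod.val_injective _ (by omega))
  have hone {x y : ZMod g} (hx : x ≠ y) (h : (x - y).val ≤ 1) : x = y + 1 := by
    have : (x - y).val ≠ 0 := by simpa [sub_eq_zero] using hx
    have h : (x - y).val = (1 : ZMod g).val := by rw [ZMod.val_one'' (by omega)]; omega
    rw [← ZMod.val_injective g h]
    ring
  refine or_iff_not_imp_right.mpr fun hne ↦ hone hij.symm ?_
  exact hc.val_sub_le_length (q := .cons h .nil) (by simp [h.ne])
    (Or.inl fun hlen ↦ hne (hone hij hlen.ge))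

theorem eq_of_common_neighbor [NeZero g] (hg : 4 < g) {i j : ZMod g} {x : V}
    (hx : x ∉ Set.range c) (hi : G.Adj (c i) x) (hj : G.Adj (c j) x) : i = j := by
  by_contra hij
  have hle {i j : ZMod g} (hij : i ≠ j) (hi : G.Adj (c i) x) (hj : G.Adj (c j) x) :
      (j - i).val ≤ 2 :=
    hc.val_sub_le_length (q := .cons hi (.cons hj.symm .nil))
      (by simp [Walk.cons_isPath_iff, hi.ne, hj.ne', hc.injective.ne hij])
      (Or.inr ⟨x, by simp, hx⟩)
  have := hle hij hi hj
  have := hle (Ne.symm hij) hj hi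
  have := val_sub_add_val_sub hij
  omega

theorem eq_six_of_adj_of_adj [NeZero g] (hg : 6 ≤ g) {i j : ZMod g} {x y : V}
    (hx : x ∉ Set.range c) (hy : y ∉ Set.range c) (hi : G.Adj (c i) x) (hj : G.Adj (c j) y)
    (hxy : G.Adj x y) : g = 6 ∧ j = i + 3 := by
  have hij : i ≠ j := by
    rintro rfl
    refine not_adj_of_adj_of_adj ?_ hi hxy hj
    rw [hc.egirth_eq]
    exact_mod_cast (by omega : 3 < g)
  have hle {i j : ZMod g} {x y : V} (hx : x ∉ Set.range c) (hy : y ∉ Set.range c) (hij : i ≠ j)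
      (hi : G.Adj (c i) x) (hj : G.Adj (c j) y) (hxy : G.Adj x y) : (j - i).val ≤ 3 :=
    hc.val_sub_le_length (q := .cons hi (.cons hxy (.cons hj.symm .nil)))
      (by
        have h₁ : c i ≠ y := fun h ↦ hy ⟨i, h⟩
        have h₂ : x ≠ c j := fun h ↦ hx ⟨j, h.symm⟩
        simp [Walk.cons_isPath_iff, hi.ne, hj.ne', hxy.ne, hc.injective.ne hij, h₁, h₂])
      (Or.inr ⟨x, by simp, hx⟩)
  have h₁ := hle hx hy hij hi hj hxy
  have h₂ := hle hy hx hij.symm hj hi hxy.symm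
  have h₃ := val_sub_add_val_sub hij
  refine ⟨by omega, ?_⟩
  have hval : (j - i).val = 3 := by omega
  have := ZMod.natCast_zmod_val (j - i)
  rw [hval] at this
  push_cast at this
  rw [this]
  ring

end IsGirthCycle

end GirthCycle

section AllValenceTwo

variable {g : ℕ} {c : ZMod g → V}

theorem IsGirthCycle.neighborSet_eq_pair (hc : IsGirthCycle G g c) (hg : 6 ≤ g)
    (h2 : ∀ v, valence G v = 2) (i : ZMod g) : G.neighborSet (c i) = {c (i - 1), c (i + 1)} := by
  refine eq_pair_of_encard_le_two (h2 _).le (hc.adj_pred i) (hc.adj_succ i)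
    (hc.injective.ne fun h ↦ ?_)
  have := zmod_numerals_pairwise_ne hg
  grind

theorem IsGirthCycle.surjective (hc : IsGirthCycle G g c) (hG : G.Connected) (hg : 6 ≤ g)
    (h2 : ∀ v, valence G v = 2) : Function.Surjective c := by
  intro v
  by_contra hv
  obtain ⟨w⟩ := hG.preconnected (c 0) v
  obtain ⟨d, -, ⟨i, hi⟩, hd⟩ := w.exists_boundary_dart (Set.range c) ⟨0, rfl⟩ hv
  have hmem : d.snd ∈ G.neighborSet (c i) := hi ▸ d.adj
  rw [hc.neighborSet_eq_pair hg h2] at hmem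
  rcases hmem with h | h <;> exact hd ⟨_, h.symm⟩

theorem IsGirthCycle.eq_self_of_fixed_of_fixed (hc : IsGirthCycle G g c) (hG : G.Connected)
    (hg : 6 ≤ g) (h2 : ∀ v, valence G v = 2) {φ : G ≃g G} (h0 : φ (c 0) = c 0)
    (h1 : φ (c 1) = c 1) (v : V) : φ v = v := by
  have : NeZero g := ⟨by omega⟩
  have key (n : ℕ) : φ (c n) = c n ∧ φ (c (n + 1)) = c (n + 1) := by
    induction n with
    | zero => simpa using ⟨h0, h1⟩
    | succ n ih =>
      push_cast
      refine ⟨ih.2, ?_⟩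
      have hmem : φ (c (n + 1 + 1)) ∈ G.neighborSet (c (n + 1)) := by
        simpa only [ih.2, mem_neighborSet] using φ.map_adj_iff.mpr (hc.adj_succ (n + 1))
      rw [hc.neighborSet_eq_pair hg h2, add_sub_cancel_right] at hmem
      refine hmem.resolve_left fun h ↦ ?_
      have h := hc.injective (φ.injective (h.trans ih.1.symm))
      have := zmod_numerals_pairwise_ne hg
      grind
  obtain ⟨i, rfl⟩ := hc.surjective hG hg h2 v
  simpa using (key i.val).1

theorem fixes_zero_and_one (hg : 6 ≤ g) {σ : ZMod g → ZMod g} (hσ : Function.Injective σ)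
    (hadj : ∀ i, σ (i + 1) = σ i - 1 ∨ σ (i + 1) = σ i + 1)
    (hmem : ∀ i, σ i = 0 ∨ σ i = 1 ∨ σ i = 3 ↔ i = 0 ∨ i = 1 ∨ i = 3) : σ 0 = 0 ∧ σ 1 = 1 := by
  have hne := zmod_numerals_pairwise_ne hg
  have h₀₁ := hadj 0
  have h₁₂ := hadj 1
  have h₂₃ := hadj 2
  have h₃₄ := hadj 3
  rw [zero_add] at h₀₁
  rw [one_add_one_eq_two] at h₁₂
  rw [two_add_one_eq_three] at h₂₃
  rw [three_add_one_eq_four] at h₃₄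
  have h₀ := hmem 0
  have h₁ := hmem 1
  have h₂ := hmem 2
  have h₃ := hmem 3
  have h₄ := hmem 4
  have hσ₂₄ := @hσ 2 4
  have hσ₁₃ := @hσ 1 3
  have hσ₀₁ := @hσ 0 1
  clear hadj hmem hσ
  have h3 : σ 3 = 3 := by grind
  have h1 : σ 1 = 1 := by grind
  exact ⟨by grind, h1⟩

theorem IsGirthCycle.isDistinguishingSet (hc : IsGirthCycle G g c) (hG : G.Connected) (hg : 6 ≤ g)
    (h2 : ∀ v, valence G v = 2) : IsDistinguishingSet G {c 0, c 1, c 3} := by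
  intro φ hφ
  have hadj {i j : ZMod g} : G.Adj (c i) (c j) ↔ j = i - 1 ∨ j = i + 1 := by
    rw [← mem_neighborSet, hc.neighborSet_eq_pair hg h2]
    simp [hc.injective.eq_iff]
  choose σ hσ using fun i ↦ hc.surjective hG hg h2 (φ (c i))
  obtain ⟨h0, h1⟩ : σ 0 = 0 ∧ σ 1 = 1 := by
    refine fixes_zero_and_one hg (fun i j h ↦ ?_) (fun i ↦ ?_) (fun i ↦ ?_)
    · rwa [← hc.injective.eq_iff, hσ, hσ, φ.injective.eq_iff, hc.injective.eq_iff] at h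
    · rw [← hadj, hσ, hσ, φ.map_adj_iff]
      exact hc.adj_succ i
    · simpa [← hσ, hc.injective.eq_iff] using hφ (c i)
  refine hc.eq_self_of_fixed_of_fixed hG hg h2 ?_ ?_
  · rw [← hσ, h0]
  · rw [← hσ, h1]

theorem exists_isDistinguishingSet_of_valence_two (hG : G.Connected) (h2 : ∀ v, valence G v = 2)
    (hcycle : ¬ G.IsAcyclic) (hg : 6 ≤ G.egirth) : ∃ S, IsDistinguishingSet G S := by
  obtain ⟨g, c, hc⟩ := exists_isGirthCycle hcycle
  rw [hc.egirth_eq] at hg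
  exact ⟨_, hc.isDistinguishingSet hG (by exact_mod_cast hg) h2⟩

end AllValenceTwo

section ValenceThree

variable {g : ℕ} {c u : ZMod g → V}

section Frame

/-- A shortest cycle `c` of length `g ≥ 6` all of whose vertices have valence three; `u i` is the
neighbor of `c i` outside the cycle. -/
structure IsFrame (G : SimpleGraph V) (g : ℕ) (c u : ZMod g → V) : Prop extends
    IsGirthCycle G g c where
  six_le : 6 ≤ g
  side_notMem (i : ZMod g) : u i ∉ Set.range c
  adj_iff (i : ZMod g) (w : V) : G.Adj (c i) w ↔ w = c (i - 1) ∨ w = c (i + 1) ∨ w = u i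

theorem IsGirthCycle.exists_isFrame (hc : IsGirthCycle G g c) (hg : 6 ≤ g)
    (h3 : ∀ v, valence G v = 3) : ∃ u, IsFrame G g c u := by
  have : NeZero g := ⟨by omega⟩
  have hpred_ne_succ (i : ZMod g) : c (i - 1) ≠ c (i + 1) := hc.injective.ne fun h ↦ by
    have := zmod_numerals_pairwise_ne hg
    grind
  have hex (i : ZMod g) : ∃ x ∈ G.neighborSet (c i), x ∉ ({c (i - 1), c (i + 1)} : Set V) := by
    refine Set.not_subset.mp fun hsub ↦ absurd (Set.encard_le_encard hsub) ?_
    rw [Set.encard_pair (hpred_ne_succ i), show (G.neighborSet (c i)).encard = 3 from h3 (c i)]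
    norm_num
  choose u hadj hne using hex
  simp only [Set.mem_insert_iff, Set.mem_singleton_iff, not_or] at hne
  refine ⟨u, hc, hg, ?_, fun i w ↦ ?_⟩
  · rintro i ⟨j, hj⟩
    obtain rfl | rfl := hc.eq_succ_or_eq_succ_of_adj (i := i) (j := j) (hj ▸ hadj i)
    · exact (hne i).2 hj.symm
    · exact (hne (j + 1)).1 (by rw [add_sub_cancel_right, hj])
  · rw [← mem_neighborSet, eq_triple_of_encard_le_three (h3 (c i)).le (hc.adj_pred i)
      (hc.adj_succ i) (hadj i) (hpred_ne_succ i) (Ne.symm (hne i).1) (Ne.symm (hne i).2)]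
    rfl

namespace IsFrame

variable (h : IsFrame G g c u)
include h

theorem neZero : NeZero g :=
  ⟨by have := h.six_le; omega⟩

theorem four_lt_egirth : 4 < G.egirth := by
  have := h.six_le
  rw [h.egirth_eq]
  exact_mod_cast (by omega : 4 < g)

theorem adj_side (i : ZMod g) : G.Adj (c i) (u i) :=
  (h.adj_iff i _).mpr (Or.inr (Or.inr rfl))

theorem side_ne_cycle (i j : ZMod g) : u i ≠ c j :=
  fun hij ↦ h.side_notMem i ⟨j, hij.symm⟩

theorem eq_of_side_adj_cycle {i j : ZMod g} (hij : G.Adj (u i) (c j)) : i = j :=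
  have := h.neZero
  h.eq_of_common_neighbor (by have := h.six_le; omega) (h.side_notMem i) (h.adj_side i) hij.symm

theorem side_injective : Function.Injective u := fun _ j hij ↦
  h.eq_of_side_adj_cycle (hij ▸ (h.adj_side j).symm)

theorem eq_six_of_side_adj_side {i j : ZMod g} (hij : G.Adj (u i) (u j)) : g = 6 ∧ j = i + 3 :=
  have := h.neZero
  h.eq_six_of_adj_of_adj h.six_le (h.side_notMem i) (h.side_notMem j) (h.adj_side i)
    (h.adj_side j) hij

theorem eq_side_of_adj {i : ZMod g} {w : V} (hw : G.Adj (c i) w) (hwB : w ∉ Set.range c) :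
    w = u i := by
  rcases (h.adj_iff i w).mp hw with rfl | rfl | rfl
  exacts [absurd ⟨_, rfl⟩ hwB, absurd ⟨_, rfl⟩ hwB, rfl]

variable (hG : G.Connected)
include hG

omit h in
theorem level_cycle (i : ZMod g) : level G (Set.range c) (c i) = 0 :=
  (level_eq_zero_iff hG (Set.range_nonempty c)).mpr ⟨i, rfl⟩

theorem level_side (i : ZMod g) : level G (Set.range c) (u i) = 1 := by
  have hB := Set.range_nonempty c
  have hle := level_le_succ hG hB (h.adj_side i)
  have hne := (level_eq_zero_iff hG hB).not.mpr (h.side_notMem i)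
  rw [level_cycle hG] at hle
  omega

theorem exists_side_of_level_eq_one {v : V} (hv : level G (Set.range c) v = 1) :
    ∃ i, v = u i := by
  have hB := Set.range_nonempty c
  have hvB : v ∉ Set.range c := by
    rw [← level_eq_zero_iff hG hB]
    omega
  obtain ⟨p, hpv, hp⟩ := parents_nonempty hG hB hvB
  obtain ⟨i, rfl⟩ := (level_eq_zero_iff hG hB).mp (by omega : level G (Set.range c) p = 0)
  exact ⟨i, h.eq_side_of_adj hpv hvB⟩

theorem level_eq_two_of_side_adj {i : ZMod g} {d : V} (hd : G.Adj (u i) d) (hc : d ≠ c i)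
    (hu : d ≠ u (i + 3)) : level G (Set.range c) d = 2 := by
  have hle := level_le_succ hG (Set.range_nonempty c) hd
  rw [h.level_side hG] at hle
  have h0 : level G (Set.range c) d ≠ 0 := fun h0 ↦ by
    obtain ⟨j, rfl⟩ := (level_eq_zero_iff hG (Set.range_nonempty c)).mp h0
    exact hc (by rw [h.eq_of_side_adj_cycle hd])
  have h1 : level G (Set.range c) d ≠ 1 := fun h1 ↦ by
    obtain ⟨j, rfl⟩ := h.exists_side_of_level_eq_one hG h1
    exact hu (by rw [(h.eq_six_of_side_adj_side hd).2])
  omega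

theorem two_le_level_of_twin {v w : V} (hvw : (twinGraph G (Set.range c)).Adj v w) :
    2 ≤ level G (Set.range c) v := by
  have hB := Set.range_nonempty c
  obtain ⟨hne, p, hv, hw⟩ := hvw
  have hpv : p ∈ parents G (Set.range c) v := hv ▸ rfl
  have hpw : p ∈ parents G (Set.range c) w := hw ▸ rfl
  have hlv := hpv.2
  by_contra hlt
  obtain ⟨i, rfl⟩ := (level_eq_zero_iff hG hB).mp (by omega : level G (Set.range c) p = 0)
  exact hne <| (h.eq_side_of_adj hpv.1 (children_subset hG hB hpv).2).trans
    (h.eq_side_of_adj hpw.1 (children_subset hG hB hpw).2).symm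

theorem isMatching_twinGraph (h3 : ∀ v, valence G v ≤ 3) :
    IsMatching (twinGraph G (Set.range c)) := by
  refine SubcubicGraph.isMatching_twinGraph hG (Set.range_nonempty c) h3 ?_
  rintro _ ⟨i, rfl⟩
  exact (Set.encard_le_encard (fun w hw ↦ h.eq_side_of_adj hw.1 hw.2)).trans
    ((Set.encard_singleton (u i)).trans_le (by norm_num))

end IsFrame

end Frame

section FrameSet

/-- The edges joining two vertices at the same distance from `B` that both have a twin: the edges
that a coloring has to keep apart from those of the cycle when `B` is a cycle. -/
def twinLayerGraph (G : SimpleGraph V) (B : Set V) : SimpleGraph V where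
  Adj x y := G.Adj x y ∧ level G B x = level G B y ∧ (∃ w, (twinGraph G B).Adj x w) ∧
    ∃ w, (twinGraph G B).Adj y w
  symm := ⟨fun _ _ ⟨h, hl, hx, hy⟩ ↦ ⟨h.symm, hl.symm, hy, hx⟩⟩

/-- The edges of `twinLayerGraph G B` between a child of `p` and a child of `q`. -/
def crossGraph (G : SimpleGraph V) (B : Set V) (p q : V) : SimpleGraph V where
  Adj x y := (twinLayerGraph G B).Adj x y ∧
    (p ∈ parents G B x ∧ q ∈ parents G B y ∨ q ∈ parents G B x ∧ p ∈ parents G B y)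
  symm := ⟨fun _ _ ⟨h, hpq⟩ ↦ ⟨h.symm, hpq.symm.imp And.symm And.symm⟩⟩

theorem isMatching_crossGraph (hg : 4 < G.egirth) {B : Set V} {p q : V} (hpq : p ≠ q) :
    IsMatching (crossGraph G B p q) := by
  have hboth {x y : V} (hxy : (twinLayerGraph G B).Adj x y) (hp : p ∈ parents G B x)
      (hq : q ∈ parents G B x) : False := by
    obtain ⟨-, -, ⟨w, -, s, hs, -⟩, -⟩ := hxy
    rw [hs] at hp hq
    exact hpq (hp.trans hq.symm)
  have hone {x y z s : V} (hxy : (twinLayerGraph G B).Adj x y) (hxz : (twinLayerGraph G B).Adj x z)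
      (hy : s ∈ parents G B y) (hz : s ∈ parents G B z) : y = z := by
    refine eq_of_adj_of_adj hg (fun hxs ↦ ?_) hxy.1 hy.1 hxz.1 hz.1
    have hl := hxy.2.1
    rw [← hy.2, hxs] at hl
    omega
  rintro x y z ⟨hxy, ⟨hx, hy⟩ | ⟨hx, hy⟩⟩ ⟨hxz, ⟨hx', hz⟩ | ⟨hx', hz⟩⟩
  · exact hone hxy hxz hy hz
  · exact (hboth hxy hx hx').elim
  · exact (hboth hxy hx' hx).elim
  · exact hone hxy hxz hy hz

/-- A set of vertices that singles out the cycle `c` of a frame: it contains the cycle and all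
`u i` but three, twins are separated, and no edge at a constant distance from the cycle has all
neighbors of its two ends in the set. -/
structure IsFrameSet (G : SimpleGraph V) (c u : ZMod g → V) (S : Set V) : Prop where
  cycle_mem (i : ZMod g) : c i ∈ S
  side_mem_iff (i : ZMod g) : u i ∈ S ↔ i ≠ 1 ∧ i ≠ 2 ∧ i ≠ 4
  exists_twin {v : V} : v ∈ S → 2 ≤ level G (Set.range c) v →
    ∃ w, (twinGraph G (Set.range c)).Adj v w
  mem_iff_of_twin {v w : V} : (twinGraph G (Set.range c)).Adj v w → (v ∈ S ↔ w ∉ S)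
  notMem_of_cross {x y : V} : G.Adj x y → u 0 ∈ parents G (Set.range c) x →
    u 5 ∈ parents G (Set.range c) y → x ∈ S → y ∉ S
  exists_adj_notMem {x y : V} : G.Adj x y → level G (Set.range c) x = level G (Set.range c) y →
    2 ≤ level G (Set.range c) x → x ∈ S → y ∈ S → ∃ z, (G.Adj x z ∨ G.Adj y z) ∧ z ∉ S

/-- The set built from a set `S₀` that separates twins; it satisfies `IsFrameSet` if `S₀` also
separates a suitable matching of `twinLayerGraph`. -/
def frameSet (G : SimpleGraph V) (c u : ZMod g → V) (S₀ : Set V) : Set V :=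
  {v | v ∈ Set.range c ∨ (∃ i, u i = v ∧ i ≠ 1 ∧ i ≠ 2 ∧ i ≠ 4) ∨
    (∃ w, (twinGraph G (Set.range c)).Adj v w) ∧ v ∈ S₀}

theorem IsFrame.mem_frameSet_iff (h : IsFrame G g c u) (hG : G.Connected) {S₀ : Set V} {v : V}
    (hv : 2 ≤ level G (Set.range c) v) :
    v ∈ frameSet G c u S₀ ↔ (∃ w, (twinGraph G (Set.range c)).Adj v w) ∧ v ∈ S₀ := by
  refine ⟨?_, fun hv ↦ Or.inr (Or.inr hv)⟩
  rintro (⟨i, rfl⟩ | ⟨i, rfl, -⟩ | hv)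
  · rw [level_cycle hG] at hv
    omega
  · rw [h.level_side hG] at hv
    omega
  · exact hv

theorem IsFrame.exists_isFrameSet (h : IsFrame G g c u) (hG : G.Connected)
    (h3 : ∀ v, valence G v ≤ 3) : ∃ S, IsFrameSet G c u S := by
  have h05 : u 0 ≠ u 5 := h.side_injective.ne <| by
    have := zmod_numerals_pairwise_ne h.six_le
    grind
  obtain ⟨N, hN, hcross, hNL, hmax⟩ := exists_maximal_isMatching
    (isMatching_crossGraph h.four_lt_egirth h05)
    fun x y (hxy : (crossGraph G _ _ _).Adj x y) ↦ hxy.1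
  obtain ⟨S₀, hS₀T, hS₀N⟩ := exists_set_separating (h.isMatching_twinGraph hG h3) hN
  have hmem {v : V} (hv : 2 ≤ level G (Set.range c) v) :=
    h.mem_frameSet_iff (S₀ := S₀) hG hv
  have hN_notMem {x z : V} (hx : 2 ≤ level G (Set.range c) x) (hxS : x ∈ frameSet G c u S₀)
      (hxz : N.Adj x z) : z ∉ frameSet G c u S₀ := by
    rw [hmem ((hNL hxz).2.1 ▸ hx)]
    exact fun hz ↦ (hS₀N x z hxz).mp ((hmem hx).mp hxS).2 hz.2
  refine ⟨frameSet G c u S₀, ?_, ?_, ?_, ?_, ?_, ?_⟩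
  · exact fun i ↦ Or.inl ⟨i, rfl⟩
  · refine fun i ↦ ⟨?_, fun hi ↦ Or.inr (Or.inl ⟨i, rfl, hi⟩)⟩
    rintro (hi | ⟨j, hji, hj⟩ | ⟨⟨w, hw⟩, -⟩)
    · exact absurd hi (h.side_notMem i)
    · rwa [← h.side_injective hji]
    · have := h.two_le_level_of_twin hG hw
      rw [h.level_side hG] at this
      omega
  · exact fun hv hl ↦ ((hmem hl).mp hv).1
  · intro v w hvw
    have hv := h.two_le_level_of_twin hG hvw
    rw [hmem hv, hmem (level_eq_of_twin hvw ▸ hv), hS₀T v w hvw]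
    exact ⟨fun hv hw ↦ hv.2 hw.2, fun hw ↦ ⟨⟨w, hvw⟩, fun hw' ↦ hw ⟨⟨v, hvw.symm⟩, hw'⟩⟩⟩
  · intro x y hxy hx hy hxS hyS
    have hlx := hx.2
    have hly := hy.2
    rw [h.level_side hG] at hlx hly
    have hx2 : 2 ≤ level G (Set.range c) x := by omega
    have hy2 : 2 ≤ level G (Set.range c) y := by omega
    refine hN_notMem hx2 hxS (hcross ⟨⟨hxy, by omega, ?_, ?_⟩, Or.inl ⟨hx, hy⟩⟩) hyS
    exacts [((hmem hx2).mp hxS).1, ((hmem hy2).mp hyS).1]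
  · intro x y hxy hl hx hxS hyS
    have hy : 2 ≤ level G (Set.range c) y := hl ▸ hx
    obtain ⟨z, hz | hz⟩ := hmax x y ⟨hxy, hl, ((hmem hx).mp hxS).1, ((hmem hy).mp hyS).1⟩
    · exact ⟨z, Or.inl (hNL hz).1, hN_notMem hx hxS hz⟩
    · exact ⟨z, Or.inr (hNL hz).1, hN_notMem hy hyS hz⟩

end FrameSet

section Core

variable {S : Set V}

/-- The vertex `v` and all its neighbors lie in `S`. -/
def IsFull (G : SimpleGraph V) (S : Set V) (v : V) : Prop :=
  v ∈ S ∧ G.neighborSet v ⊆ S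

/-- The full vertices that have a full neighbor. For the set of a frame these are vertices of the
cycle only, which is how automorphisms preserving the set are located. -/
def core (G : SimpleGraph V) (S : Set V) : Set V :=
  {v | IsFull G S v ∧ ∃ w, G.Adj v w ∧ IsFull G S w}

theorem mem_core_of_adj {v w : V} (hv : IsFull G S v) (hvw : G.Adj v w) (hw : IsFull G S w) :
    v ∈ core G S :=
  ⟨hv, w, hvw, hw⟩

theorem isFull_map_iff {φ : G ≃g G} (hφ : ∀ v, φ v ∈ S ↔ v ∈ S) (v : V) :
    IsFull G S (φ v) ↔ IsFull G S v := by
  rw [IsFull, IsFull, hφ, neighborSet_map, Set.image_subset_iff, show φ ⁻¹' S = S from Set.ext hφ]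

theorem map_mem_core_iff {φ : G ≃g G} (hφ : ∀ v, φ v ∈ S ↔ v ∈ S) (v : V) :
    φ v ∈ core G S ↔ v ∈ core G S := by
  refine and_congr (isFull_map_iff hφ v) (φ.surjective.exists.trans (exists_congr fun w ↦ ?_))
  rw [φ.map_adj_iff, isFull_map_iff hφ]

theorem subsingleton_core_neighbors_map {φ : G ≃g G} (hφ : ∀ v, φ v ∈ S ↔ v ∈ S) {v : V}
    (hv : (G.neighborSet v ∩ core G S).Subsingleton) :
    (G.neighborSet (φ v) ∩ core G S).Subsingleton := by
  have hcore : φ ⁻¹' core G S = core G S := Set.ext (map_mem_core_iff hφ)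
  rw [neighborSet_map, ← Set.image_inter_preimage, hcore]
  exact hv.image φ

namespace IsFrameSet

theorem notMem_parents_of_isFull (hS : IsFrameSet G c u S) {v k : V} (hv : IsFull G S v)
    (hk : 2 ≤ level G (Set.range c) k) : v ∉ parents G (Set.range c) k := by
  intro hvk
  have hkS : k ∈ S := hv.2 hvk.1
  obtain ⟨w, hkw⟩ := hS.exists_twin hkS hk
  refine (hS.mem_iff_of_twin hkw).mp hkS (hv.2 ?_)
  obtain ⟨-, p, hkp, hwp⟩ := hkw
  rw [hkp, ← hwp] at hvk
  exact hvk.1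

variable (h : IsFrame G g c u) (hS : IsFrameSet G c u S)
include h hS

theorem isFull_cycle_iff (i : ZMod g) : IsFull G S (c i) ↔ i ≠ 1 ∧ i ≠ 2 ∧ i ≠ 4 := by
  rw [← hS.side_mem_iff]
  refine ⟨fun hi ↦ hi.2 (h.adj_side i), fun hi ↦ ⟨hS.cycle_mem i, fun w hw ↦ ?_⟩⟩
  rcases (h.adj_iff i w).mp hw with rfl | rfl | rfl
  exacts [hS.cycle_mem _, hS.cycle_mem _, hi]

variable (hG : G.Connected) (h3 : ∀ v, valence G v = 3)
include hG h3

theorem not_isFull_side (i : ZMod g) : ¬ IsFull G S (u i) := by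
  intro hi
  have hsub : G.neighborSet (u i) ⊆ {c i, u (i + 3)} := by
    intro d hd
    by_contra! hne
    simp only [Set.mem_insert_iff, Set.mem_singleton_iff, not_or] at hne
    have hl := h.level_eq_two_of_side_adj hG hd hne.1 hne.2
    exact hS.notMem_parents_of_isFull hi hl.ge ⟨hd, by rw [hl, h.level_side hG]⟩
  have hle := Set.encard_le_encard hsub
  rw [show (G.neighborSet (u i)).encard = 3 from h3 _,
    Set.encard_pair (h.side_ne_cycle _ _).symm] at hle
  norm_num at hle

theorem two_le_level_of_isFull {v : V} (hv : IsFull G S v) (hvB : v ∉ Set.range c) :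
    2 ≤ level G (Set.range c) v := by
  have h0 := (level_eq_zero_iff hG (Set.range_nonempty c)).not.mpr hvB
  have h1 : level G (Set.range c) v ≠ 1 := fun h1 ↦ by
    obtain ⟨i, rfl⟩ := h.exists_side_of_level_eq_one hG h1
    exact not_isFull_side h hS hG h3 i hv
  omega

theorem core_subset_range : core G S ⊆ Set.range c := by
  rintro v ⟨hv, w, hvw, hw⟩
  by_contra hvB
  have hwB : w ∉ Set.range c := by
    rintro ⟨i, rfl⟩
    exact not_isFull_side h hS hG h3 i (h.eq_side_of_adj hvw.symm hvB ▸ hv)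
  have hB := Set.range_nonempty c
  have hlv := two_le_level_of_isFull h hS hG h3 hv hvB
  have hlw := two_le_level_of_isFull h hS hG h3 hw hwB
  have hlevel : level G (Set.range c) v = level G (Set.range c) w := by
    have hvw' := level_le_succ hG hB hvw
    have hwv' := level_le_succ hG hB hvw.symm
    have hnvw : ¬ level G (Set.range c) v + 1 = level G (Set.range c) w :=
      fun hl ↦ hS.notMem_parents_of_isFull hv hlw ⟨hvw, hl⟩
    have hnwv : ¬ level G (Set.range c) w + 1 = level G (Set.range c) v :=
      fun hl ↦ hS.notMem_parents_of_isFull hw hlv ⟨hvw.symm, hl⟩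
    omega
  obtain ⟨z, hz | hz, hzS⟩ := hS.exists_adj_notMem hvw hlevel hlv hv.1 hw.1
  exacts [hzS (hv.2 hz), hzS (hw.2 hz)]

theorem cycle_mem_core_iff (i : ZMod g) :
    c i ∈ core G S ↔ i ≠ 1 ∧ i ≠ 2 ∧ i ≠ 3 ∧ i ≠ 4 := by
  have := h.neZero
  have hne := zmod_numerals_pairwise_ne h.six_le
  constructor
  · rintro ⟨hi, w, hiw, hw⟩
    obtain ⟨j, rfl⟩ := core_subset_range h hS hG h3 (mem_core_of_adj hw hiw.symm hi)
    rw [isFull_cycle_iff h hS] at hi hw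
    have := h.eq_succ_or_eq_succ_of_adj hiw
    grind
  · intro hi
    have hfull : IsFull G S (c i) := (isFull_cycle_iff h hS i).mpr ⟨hi.1, hi.2.1, hi.2.2.2⟩
    by_cases h0 : i = 0
    · refine mem_core_of_adj hfull (h.adj_pred i) ((isFull_cycle_iff h hS _).mpr ?_)
      grind
    · refine mem_core_of_adj hfull (h.adj_succ i) ((isFull_cycle_iff h hS _).mpr ?_)
      grind

theorem cycle_pred_zero_mem_core : c (0 - 1) ∈ core G S := by
  have hne := zmod_numerals_pairwise_ne h.six_le
  rw [cycle_mem_core_iff h hS hG h3]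
  simp only [ne_eq, sub_eq_iff_eq_add]
  norm_num
  grind

theorem cycle_succ_five_mem_core : c (5 + 1) ∈ core G S := by
  have hne := zmod_numerals_pairwise_ne h.six_le
  rw [cycle_mem_core_iff h hS hG h3]
  simp only [ne_eq, ← eq_sub_iff_add_eq]
  norm_num
  grind

theorem subsingleton_core_neighbors_iff {i : ZMod g} (hi : c i ∈ core G S) :
    (G.neighborSet (c i) ∩ core G S).Subsingleton ↔ i = 0 ∨ i = 5 := by
  have := h.neZero
  have hne := zmod_numerals_pairwise_ne h.six_le
  have hcore := cycle_mem_core_iff h hS hG h3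
  rw [hcore] at hi
  constructor
  · intro hsub
    by_contra! hi05
    have heq := h.injective <| hsub ⟨h.adj_pred i, (hcore (i - 1)).mpr (by grind)⟩
      ⟨h.adj_succ i, (hcore (i + 1)).mpr (by grind)⟩
    grind
  · rintro hi05 x ⟨hx, hxc⟩ y ⟨hy, hyc⟩
    obtain ⟨j, rfl⟩ := core_subset_range h hS hG h3 hxc
    obtain ⟨k, rfl⟩ := core_subset_range h hS hG h3 hyc
    rw [hcore] at hxc hyc
    have := h.eq_succ_or_eq_succ_of_adj hx
    have := h.eq_succ_or_eq_succ_of_adj hy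
    exact congrArg c (by grind)

end IsFrameSet

end Core

section FrameRigidity

namespace IsFrameSet

variable {S : Set V} (h : IsFrame G g c u) (hS : IsFrameSet G c u S) (hG : G.Connected)
  (h3 : ∀ v, valence G v = 3)
include h hS hG h3

theorem eq_cycle_of_path_of_eq {d₂ d₃ d₄ : V} (h₁₂ : G.Adj (c 1) d₂) (h₂₃ : G.Adj d₂ d₃)
    (h₃₄ : G.Adj d₃ d₄) (h₄₅ : G.Adj d₄ (c 5)) (hd₂S : d₂ ∈ S) (hd₃S : d₃ ∈ S) (h₁₃ : c 1 ≠ d₃)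
    (h₂₄ : d₂ ≠ d₄) (hd₂ : d₂ ∉ core G S) : d₂ = c 2 ∧ d₃ = c 3 ∧ d₄ = c 4 := by
  have := h.neZero
  have hne := zmod_numerals_pairwise_ne h.six_le
  have hcore := cycle_mem_core_iff h hS hG h3
  obtain rfl : d₂ = c 2 := by
    rcases (h.adj_iff 1 d₂).mp h₁₂ with rfl | rfl | rfl
    · rw [sub_self] at hd₂
      exact absurd ((hcore 0).mpr (by grind)) hd₂
    · exact congrArg c (by ring)
    · exact absurd rfl ((hS.side_mem_iff 1).mp hd₂S).1
  obtain rfl : d₃ = c 3 := by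
    rcases (h.adj_iff 2 d₃).mp h₂₃ with rfl | rfl | rfl
    · exact absurd (congrArg c (by ring)) h₁₃
    · exact congrArg c (by ring)
    · exact absurd rfl ((hS.side_mem_iff 2).mp hd₃S).2.1
  refine ⟨rfl, rfl, ?_⟩
  rcases (h.adj_iff 3 d₄).mp h₃₄ with rfl | rfl | rfl
  · exact absurd (congrArg c (by ring)) h₂₄
  · exact congrArg c (by ring)
  · have := h.eq_of_side_adj_cycle h₄₅
    grind

theorem not_path_of_side (hside : ¬ G.Adj (u 0) (u 3)) {d₂ d₃ d₄ : V} (h₁₂ : G.Adj (u 0) d₂)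
    (h₂₃ : G.Adj d₂ d₃) (h₃₄ : G.Adj d₃ d₄) (hd₄ : d₄ = c 4 ∨ d₄ = u 5) (hd₂S : d₂ ∈ S)
    (hd₃S : d₃ ∈ S) (hd₂ : d₂ ∉ core G S) (hd₃ : d₃ ∉ core G S) : False := by
  have := h.neZero
  have hne := zmod_numerals_pairwise_ne h.six_le
  have hcore := cycle_mem_core_iff h hS hG h3
  have hl₂ : level G (Set.range c) d₂ = 2 := by
    refine h.level_eq_two_of_side_adj hG h₁₂ ?_ ?_
    · rintro rfl
      exact hd₂ ((hcore 0).mpr (by grind))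
    · rintro rfl
      exact hside (by rwa [zero_add] at h₁₂)
  have hd₃_ne {i : ZMod g} : d₃ ≠ c i := by
    rintro rfl
    have := level_le_succ hG (Set.range_nonempty c) h₂₃.symm
    rw [hl₂, IsFrame.level_cycle hG] at this
    omega
  rcases hd₄ with rfl | rfl
  · rcases (h.adj_iff 4 d₃).mp h₃₄.symm with hd | hd | rfl
    · exact hd₃_ne hd
    · exact hd₃_ne hd
    · exact ((hS.side_mem_iff 4).mp hd₃S).2.2 rfl
  · have hl₃ : level G (Set.range c) d₃ = 2 := by
      refine h.level_eq_two_of_side_adj hG h₃₄.symm hd₃_ne ?_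
      rintro rfl
      have h60 : ((6 : ℕ) : ZMod g) = 0 := (ZMod.natCast_eq_zero_iff 6 g).mpr
        (h.eq_six_of_side_adj_side h₃₄.symm).1.dvd
      push_cast at h60
      exact ((hS.side_mem_iff _).mp hd₃S).2.1 (by linear_combination h60)
    refine hS.notMem_of_cross h₂₃ ⟨h₁₂, ?_⟩ ⟨h₃₄.symm, ?_⟩ hd₂S hd₃S
    · rw [h.level_side hG, hl₂]
    · rw [h.level_side hG, hl₃]

theorem eq_cycle_of_path (hside : ¬ G.Adj (u 0) (u 3)) {d₁ d₂ d₃ d₄ : V}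
    (h₀₁ : G.Adj (c 0) d₁) (h₁₂ : G.Adj d₁ d₂) (h₂₃ : G.Adj d₂ d₃) (h₃₄ : G.Adj d₃ d₄)
    (h₄₅ : G.Adj d₄ (c 5)) (hd₂S : d₂ ∈ S) (hd₃S : d₃ ∈ S) (h₁₃ : d₁ ≠ d₃) (h₂₄ : d₂ ≠ d₄)
    (hd₁ : d₁ ∉ core G S) (hd₂ : d₂ ∉ core G S) (hd₃ : d₃ ∉ core G S) (hd₄ : d₄ ∉ core G S) :
    d₁ = c 1 ∧ d₂ = c 2 ∧ d₃ = c 3 ∧ d₄ = c 4 := by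
  have h₄ : d₄ = c 4 ∨ d₄ = u 5 := by
    rcases (h.adj_iff 5 d₄).mp h₄₅.symm with rfl | rfl | rfl
    · exact Or.inl (congrArg c (by ring))
    · exact absurd (cycle_succ_five_mem_core h hS hG h3) hd₄
    · exact Or.inr rfl
  rcases (h.adj_iff 0 d₁).mp h₀₁ with rfl | rfl | rfl
  · exact absurd (cycle_pred_zero_mem_core h hS hG h3) hd₁
  · rw [zero_add] at h₁₂ h₁₃ ⊢
    exact ⟨rfl, eq_cycle_of_path_of_eq h hS hG h3 h₁₂ h₂₃ h₃₄ h₄₅ hd₂S hd₃S h₁₃ h₂₄ hd₂⟩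
  · exact (not_path_of_side h hS hG h3 hside h₁₂ h₂₃ h₃₄ h₄ hd₂S hd₃S hd₂ hd₃).elim

variable {φ : G ≃g G} (hφ : ∀ v, φ v ∈ S ↔ v ∈ S)
include hφ

theorem map_end {i : ZMod g} (hi : i = 0 ∨ i = 5) : φ (c i) = c 0 ∨ φ (c i) = c 5 := by
  have hne := zmod_numerals_pairwise_ne h.six_le
  have hcore : c i ∈ core G S := (cycle_mem_core_iff h hS hG h3 i).mpr (by grind)
  have hφcore := (map_mem_core_iff hφ _).mpr hcore
  obtain ⟨j, hj⟩ := core_subset_range h hS hG h3 hφcore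
  have hsub := subsingleton_core_neighbors_map hφ
    ((subsingleton_core_neighbors_iff h hS hG h3 hcore).mpr hi)
  rw [← hj] at hφcore hsub ⊢
  exact ((subsingleton_core_neighbors_iff h hS hG h3 hφcore).mp hsub).imp (congrArg c) (congrArg c)

omit hG h3 in
theorem not_map_swap (h₂ : φ (c 2) = c 3) (h₃ : φ (c 3) = c 2) (h₄ : φ (c 4) = c 1) : False := by
  have hne := zmod_numerals_pairwise_ne h.six_le
  have hu := φ.map_adj_iff.mpr (h.adj_side 3)
  rw [h₃] at hu
  have hu_ne (i : ZMod g) : φ (u 3) ≠ φ (c i) := φ.injective.ne (h.side_ne_cycle 3 i)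
  rcases (h.adj_iff 2 _).mp hu with hu | hu | hu
  · exact hu_ne 4 (hu.trans (h₄.trans (congrArg c (by ring))).symm)
  · exact hu_ne 2 (hu.trans (h₂.trans (congrArg c (by ring))).symm)
  · have hu₃ : u 3 ∈ S := (hS.side_mem_iff 3).mpr (by grind)
    rw [← hφ, hu] at hu₃
    exact absurd rfl ((hS.side_mem_iff 2).mp hu₃).2.1

variable (hside : ¬ G.Adj (u 0) (u 3))
include hside

theorem map_arc_of_map_ends (h05 : φ (c 0) = c 0 ∧ φ (c 5) = c 5 ∨ φ (c 0) = c 5 ∧ φ (c 5) = c 0) :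
    (φ (c 1) = c 1 ∧ φ (c 2) = c 2 ∧ φ (c 3) = c 3 ∧ φ (c 4) = c 4) ∧ φ (c 0) = c 0 := by
  have hne := zmod_numerals_pairwise_ne h.six_le
  have hadj {i j : ZMod g} (hij : i + 1 = j) : G.Adj (φ (c i)) (φ (c j)) :=
    φ.map_adj_iff.mpr (hij ▸ h.adj_succ i)
  have h₀₁ := hadj (i := 0) (j := 1) (by ring)
  have h₁₂ := hadj (i := 1) (j := 2) (by ring)
  have h₂₃ := hadj (i := 2) (j := 3) (by ring)
  have h₃₄ := hadj (i := 3) (j := 4) (by ring)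
  have h₄₅ := hadj (i := 4) (j := 5) (by ring)
  have hmem (i : ZMod g) : φ (c i) ∈ S := (hφ _).mpr (hS.cycle_mem i)
  have hcore {i : ZMod g} (hi : i = 1 ∨ i = 2 ∨ i = 3 ∨ i = 4) : φ (c i) ∉ core G S := by
    rw [map_mem_core_iff hφ, cycle_mem_core_iff h hS hG h3]
    grind
  have hinj {i j : ZMod g} (hij : i ≠ j) : φ (c i) ≠ φ (c j) := φ.injective.ne (h.injective.ne hij)
  have h₁₃ := hinj (i := 1) (j := 3) (by grind)
  have h₂₄ := hinj (i := 2) (j := 4) (by grind)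
  have n₁ := hcore (i := 1) (by simp)
  have n₂ := hcore (i := 2) (by simp)
  have n₃ := hcore (i := 3) (by simp)
  have n₄ := hcore (i := 4) (by simp)
  obtain ⟨h0, h5⟩ | ⟨h0, h5⟩ := h05
  · rw [h0] at h₀₁
    rw [h5] at h₄₅
    exact ⟨eq_cycle_of_path h hS hG h3 hside h₀₁ h₁₂ h₂₃ h₃₄ h₄₅ (hmem 2) (hmem 3) h₁₃ h₂₄
      n₁ n₂ n₃ n₄, h0⟩
  · rw [h0] at h₀₁
    rw [h5] at h₄₅
    obtain ⟨e₄, e₃, e₂, -⟩ := eq_cycle_of_path h hS hG h3 hside h₄₅.symm h₃₄.symm h₂₃.symm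
      h₁₂.symm h₀₁.symm (hmem 3) (hmem 2) h₂₄.symm h₁₃.symm n₄ n₃ n₂ n₁
    exact (not_map_swap h hS hφ e₂ e₃ e₄).elim

theorem map_arc :
    (φ (c 1) = c 1 ∧ φ (c 2) = c 2 ∧ φ (c 3) = c 3 ∧ φ (c 4) = c 4) ∧ φ (c 0) = c 0 := by
  refine map_arc_of_map_ends h hS hG h3 hφ hside ?_
  have hne := zmod_numerals_pairwise_ne h.six_le
  have h05 : φ (c 0) ≠ φ (c 5) := φ.injective.ne (h.injective.ne (by grind))
  have h0 := map_end h hS hG h3 hφ (i := 0) (Or.inl rfl)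
  have h5 := map_end h hS hG h3 hφ (i := 5) (Or.inr rfl)
  grind

theorem map_cycle_add_two {i : ZMod g} (hi : φ (c i) = c i) (hi' : φ (c (i + 1)) = c (i + 1)) :
    φ (c (i + 1 + 1)) = c (i + 1 + 1) := by
  by_cases hcore : c (i + 1 + 1) ∈ core G S
  · obtain ⟨j, hj⟩ := core_subset_range h hS hG h3 ((map_mem_core_iff hφ _).mpr hcore)
    have hadj := φ.map_adj_iff.mpr (h.adj_succ (i + 1))
    rw [hi', h.adj_iff] at hadj
    have := h.neZero
    have := zmod_numerals_pairwise_ne h.six_le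
    rcases hadj with hback | hnext | hside
    · rw [add_sub_cancel_right, ← hi] at hback
      have := h.injective (φ.injective hback)
      grind
    · exact hnext
    · exact absurd (hj.trans hside).symm (h.side_ne_cycle _ _)
  · obtain ⟨⟨h1, h2, h3', h4⟩, -⟩ := map_arc h hS hG h3 hφ hside
    rw [cycle_mem_core_iff h hS hG h3] at hcore
    grind

theorem map_cycle (i : ZMod g) : φ (c i) = c i := by
  have := h.neZero
  obtain ⟨⟨h1, -⟩, h0⟩ := map_arc h hS hG h3 hφ hside
  have hstep (n : ℕ) : φ (c n) = c n ∧ φ (c (n + 1)) = c (n + 1) := by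
    induction n with
    | zero => simpa only [Nat.cast_zero, zero_add] using ⟨h0, h1⟩
    | succ n ih =>
      rw [Nat.cast_succ]
      exact ⟨ih.2, map_cycle_add_two h hS hG h3 hφ hside ih.1 ih.2⟩
  simpa only [ZMod.natCast_zmod_val] using (hstep i.val).1

end IsFrameSet

theorem exists_isDistinguishingSet_of_frame (h : IsFrame G g c u) (hG : G.Connected)
    (h3 : ∀ v, valence G v = 3) (hside : ¬ G.Adj (u 0) (u 3)) :
    ∃ S, IsDistinguishingSet G S := by
  obtain ⟨S, hS⟩ := h.exists_isFrameSet hG fun v ↦ (h3 v).le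
  refine ⟨S, fun φ hφ ↦ eq_self_of_not_twin hG (Set.range_nonempty c) h.four_lt_egirth ?_ ?_⟩
  · rintro _ ⟨i, rfl⟩
    exact hS.map_cycle h hG h3 hφ hside i
  · intro v hv
    have := hS.mem_iff_of_twin hv
    rw [hφ] at this
    exact iff_not_self this

end FrameRigidity

end ValenceThree

section ColorRefinement

/-- One round of color refinement: the color of a vertex is combined with the colors of its
neighbors. The squares only serve to tell apart more multisets of neighboring colors. -/
def colorRefinement [Fintype V] (G : SimpleGraph V) [DecidableRel G.Adj] (f : V → ℕ) (v : V) : ℕ :=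
  f v + ∑ w, if G.Adj v w then f w ^ 2 else 0

theorem colorRefinement_map [Fintype V] [DecidableRel G.Adj] {f : V → ℕ} {φ : G ≃g G}
    (hφ : ∀ v, f (φ v) = f v) (v : V) :
    colorRefinement G f (φ v) = colorRefinement G f v := by
  rw [colorRefinement, hφ, ← φ.toEquiv.sum_comp]
  simp only [RelIso.coe_fn_toEquiv, φ.map_adj_iff, hφ, colorRefinement]

end ColorRefinement

section Heawood

/-- The Heawood graph, presented as a hexagon `inl i`, its side vertices `inr (inl i)`, opposite
ones of which are adjacent, and two hubs `inr (inr b)` adjacent to the sides of parity `b`. -/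
def heawood : SimpleGraph (ZMod 6 ⊕ ZMod 6 ⊕ ZMod 2) :=
  fromRel fun
    | .inl i, .inl j => j = i + 1
    | .inl i, .inr (.inl j) => i = j
    | .inr (.inl i), .inr (.inl j) => j = i + 3
    | .inr (.inl i), .inr (.inr b) => (i.cast : ZMod 2) = b
    | _, _ => False

instance : DecidableRel heawood.Adj := by
  rintro (i | i | b) (j | j | b') <;> exact inferInstanceAs (Decidable (_ ∧ _))

/-- Five vertices of the Heawood graph: a path of four on the hexagon and one side vertex. -/
def heawoodSet : Finset (ZMod 6 ⊕ ZMod 6 ⊕ ZMod 2) :=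
  {.inl 0, .inl 1, .inl 2, .inl 3, .inr (.inl 4)}

theorem colorRefinement_heawoodSet_injective :
    Function.Injective (colorRefinement heawood (colorRefinement heawood
      fun v ↦ if v ∈ heawoodSet then 1 else 0)) := by
  decide +kernel

theorem isDistinguishingSet_heawoodSet : IsDistinguishingSet heawood heawoodSet := by
  intro φ hφ v
  refine colorRefinement_heawoodSet_injective (colorRefinement_map (colorRefinement_map ?_) v)
  simpa only [Finset.mem_coe] using fun v ↦ if_congr (hφ v) rfl rfl

theorem valence_heawood (v : ZMod 6 ⊕ ZMod 6 ⊕ ZMod 2) : valence heawood v = 3 := by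
  have hreg : ∀ v, heawood.degree v = 3 := by decide +kernel
  rw [valence, ← coe_neighborFinset, Set.encard_coe_eq_coe_finsetCard,
    card_neighborFinset_eq_degree, hreg v]
  rfl

end Heawood

section Hom

variable {W : Type*} {H : SimpleGraph W}

theorem IsDistinguishingSet.image {T : Set W} (hT : IsDistinguishingSet H T) (e : H ≃g G) :
    IsDistinguishingSet G (e '' T) := by
  intro φ hφ v
  have hfix := hT ((e.trans φ).trans e.symm) (fun w ↦ ?_) (e.symm v)
  · simpa using hfix
  · have := hφ (e w)
    rwa [e.injective.mem_set_image, ← e.apply_symm_apply (φ (e w)),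
      e.injective.mem_set_image] at this

theorem fromRel_le_comap {r : W → W → Prop} {f : W → V} (hf : ∀ a b, r a b → G.Adj (f a) (f b)) :
    fromRel r ≤ G.comap f := by
  rintro a b ⟨-, hab | hba⟩
  exacts [hf a b hab, (hf b a hba).symm]

theorem image_neighborSet_of_valence_le {f : H →g G} (hf : Function.Injective f) {w : W}
    (hfin : (H.neighborSet w).Finite) (hval : valence G (f w) ≤ valence H w) :
    f '' H.neighborSet w = G.neighborSet (f w) := by
  refine (hfin.image f).eq_of_subset_of_encard_le ?_ (hval.trans_eq (hf.encard_image _).symm)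
  rintro _ ⟨w', hw', rfl⟩
  exact f.map_adj hw'

theorem nonempty_iso_of_valence_le [Nonempty W] (hG : G.Connected) {f : H →g G}
    (hf : Function.Injective f) (hfin : ∀ w, (H.neighborSet w).Finite)
    (hval : ∀ w, valence G (f w) ≤ valence H w) : Nonempty (H ≃g G) := by
  have himage (w : W) := image_neighborSet_of_valence_le hf (hfin w) (hval w)
  have hsurj : Function.Surjective f := by
    intro v
    by_contra hv
    obtain ⟨w₀⟩ := ‹Nonempty W›
    obtain ⟨p⟩ := hG.preconnected (f w₀) v
    obtain ⟨d, -, ⟨w, hw⟩, hd⟩ := p.exists_boundary_dart (Set.range f) ⟨w₀, rfl⟩ hv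
    have hmem : d.snd ∈ G.neighborSet (f w) := hw ▸ d.adj
    rw [← himage] at hmem
    exact hd (Set.image_subset_range _ _ hmem)
  refine ⟨⟨Equiv.ofBijective f ⟨hf, hsurj⟩, fun {a b} ↦ ?_⟩⟩
  change f b ∈ G.neighborSet (f a) ↔ b ∈ H.neighborSet a
  rw [← himage, hf.mem_set_image]

end Hom

section OppositeSides

variable {c u : ZMod 6 → V}

theorem adj_of_adj_opposite (hopp : ∀ {c u}, IsFrame G 6 c u → G.Adj (u 0) (u 3))
    (h3 : ∀ v, valence G v = 3) (hc : IsGirthCycle G 6 c) {x y : V} (hx : G.Adj (c 0) x)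
    (hxc : x ∉ Set.range c) (hy : G.Adj (c 3) y) (hyc : y ∉ Set.range c) : G.Adj x y := by
  obtain ⟨u, hu⟩ := hc.exists_isFrame le_rfl h3
  rw [hu.eq_side_of_adj hx hxc, hu.eq_side_of_adj hy hyc]
  exact hopp hu

/-- The hexagon `c (i + 2), c (i + 3), u (i + 3), u i, c i, c (i + 1)` of a frame in which opposite
sides are adjacent, with `inl` standing for `c` and `inr` for `u`. -/
def hexagonIndex (i : ZMod 6) : ZMod 6 → ZMod 6 ⊕ ZMod 6 :=
  ![.inl (i + 2), .inl (i + 3), .inr (i + 3), .inr i, .inl i, .inl (i + 1)]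

namespace IsFrame

variable (h : IsFrame G 6 c u)
include h

theorem rotate (k : ZMod 6) : IsFrame G 6 (fun i ↦ c (i + k)) fun i ↦ u (i + k) where
  injective := h.injective.comp (add_left_injective k)
  adj_succ i := add_right_comm i k 1 ▸ h.adj_succ (i + k)
  egirth_eq := h.egirth_eq
  six_le := h.six_le
  side_notMem i := fun ⟨_, hj⟩ ↦ h.side_ne_cycle _ _ hj.symm
  adj_iff i w := by
    rw [add_right_comm, sub_add_eq_add_sub]
    exact h.adj_iff (i + k) w

theorem sumElim_injective : Function.Injective (Sum.elim c u) :=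
  h.injective.sumElim h.side_injective fun i j ↦ (h.side_ne_cycle j i).symm

theorem exists_hub (h3 : ∀ v, valence G v = 3) (hside : ∀ i, G.Adj (u i) (u (i + 3))) :
    ∃ x : ZMod 6 → V, ∀ i, x i ∉ Set.range c ∧ x i ∉ Set.range u ∧
      ∀ w, G.Adj (u i) w ↔ w = c i ∨ w = u (i + 3) ∨ w = x i := by
  have hex (i : ZMod 6) : ∃ x ∈ G.neighborSet (u i), x ∉ ({c i, u (i + 3)} : Set V) := by
    refine Set.not_subset.mp fun hsub ↦ absurd (Set.encard_le_encard hsub) ?_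
    rw [Set.encard_pair (h.side_ne_cycle _ _).symm,
      show (G.neighborSet (u i)).encard = 3 from h3 (u i)]
    norm_num
  choose x hadj hne using hex
  simp only [Set.mem_insert_iff, Set.mem_singleton_iff, not_or] at hne
  refine ⟨x, fun i ↦ ⟨?_, ?_, fun w ↦ ?_⟩⟩
  · rintro ⟨j, hj⟩
    have hij := h.eq_of_side_adj_cycle (i := i) (j := j) (hj ▸ hadj i)
    exact (hne i).1 (hij ▸ hj.symm)
  · rintro ⟨j, hj⟩
    have hij := (h.eq_six_of_side_adj_side (i := i) (j := j) (hj ▸ hadj i)).2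
    exact (hne i).2 (hij ▸ hj.symm)
  · rw [← mem_neighborSet, eq_triple_of_encard_le_three (h3 (u i)).le (h.adj_side i).symm
      (hside i) (hadj i) (h.side_ne_cycle _ _).symm (Ne.symm (hne i).1) (Ne.symm (hne i).2)]
    rfl

variable (hopp : ∀ {c u}, IsFrame G 6 c u → G.Adj (u 0) (u 3)) (h3 : ∀ v, valence G v = 3)
include hopp

theorem side_adj_side (i : ZMod 6) : G.Adj (u i) (u (i + 3)) := by
  simpa only [zero_add, add_comm i 3] using hopp (h.rotate i)

theorem isGirthCycle_hexagonIndex (i : ZMod 6) :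
    IsGirthCycle G 6 (Sum.elim c u ∘ hexagonIndex i) where
  injective := (h.sumElim_injective).comp (by revert i; decide)
  adj_succ j := by
    have hadj {j k : ZMod 6} (hjk : j + 1 = k) : G.Adj (c j) (c k) := hjk ▸ h.adj_succ j
    fin_cases j
    exacts [hadj (by ring), h.adj_side (i + 3), (side_adj_side h hopp i).symm,
      (h.adj_side i).symm, h.adj_succ i, hadj (by ring)]
  egirth_eq := h.egirth_eq

include h3

theorem hub_eq {x : ZMod 6 → V} (hx : ∀ i, x i ∉ Set.range c ∧ x i ∉ Set.range u ∧
      ∀ w, G.Adj (u i) w ↔ w = c i ∨ w = u (i + 3) ∨ w = x i) (i : ZMod 6) : x i = x (i + 2) := by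
  have hadj : G.Adj (u (i + 2)) (x i) := by
    refine adj_of_adj_opposite hopp h3 (isGirthCycle_hexagonIndex h hopp i) (h.adj_side _) ?_
      (((hx i).2.2 _).mpr (Or.inr (Or.inr rfl))) ?_
    · rintro ⟨j, hj⟩
      have hidx : ∀ i j, hexagonIndex i j ≠ .inr (i + 2) := by decide
      exact hidx i j (h.sumElim_injective hj)
    · rintro ⟨j, hj⟩
      rcases hidx : hexagonIndex i j with k | k <;>
        simp only [Function.comp_apply, hidx, Sum.elim_inl, Sum.elim_inr] at hj
      exacts [(hx i).1 ⟨k, hj⟩, (hx i).2.1 ⟨k, hj⟩]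
  rcases ((hx (i + 2)).2.2 _).mp hadj with hc | hu | hx'
  · exact absurd ⟨_, hc.symm⟩ (hx i).1
  · exact absurd ⟨_, hu.symm⟩ (hx i).2.1
  · exact hx'

theorem exists_parity_hub : ∃ y : ZMod 2 → V,
    (∀ b, y b ∉ Set.range c ∧ y b ∉ Set.range u) ∧ ∀ i : ZMod 6, G.Adj (u i) (y i.cast) := by
  obtain ⟨x, hx⟩ := exists_hub h h3 (side_adj_side h hopp)
  refine ⟨fun b ↦ x b.val, fun b ↦ ⟨(hx _).1, (hx _).2.1⟩, fun i ↦ ?_⟩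
  have hparity : x (i.cast : ZMod 2).val = x i := by
    have hcases : ∀ i : ZMod 6, ((i.cast : ZMod 2).val : ZMod 6) = i ∨
      ((i.cast : ZMod 2).val : ZMod 6) = i + 2 ∨
      ((i.cast : ZMod 2).val : ZMod 6) = i + 2 + 2 := by decide
    have hx2 := hub_eq h hopp h3 hx
    rcases hcases i with hi | hi | hi <;> rw [hi]
    exacts [(hx2 i).symm, ((hx2 i).trans (hx2 _)).symm]
  exact ((hx i).2.2 _).mpr (Or.inr (Or.inr hparity))

theorem nonempty_heawood_iso (hG : G.Connected) : Nonempty (heawood ≃g G) := by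
  obtain ⟨y, hy, hadj⟩ := exists_parity_hub h hopp h3
  have hy₀₁ : y 0 ≠ y 1 := fun h01 ↦
    not_adj_of_adj_of_adj (h.four_lt_egirth.trans' (by norm_num)) (side_adj_side h hopp 0)
      (hadj (0 + 3)) (h01 ▸ hadj 0)
  have hy_inj : Function.Injective y := by
    intro a b hab
    fin_cases a <;> fin_cases b
    exacts [rfl, (hy₀₁ hab).elim, (hy₀₁ hab.symm).elim, rfl]
  let f : ZMod 6 ⊕ ZMod 6 ⊕ ZMod 2 → V := Sum.elim c (Sum.elim u y)
  have hf : Function.Injective f := by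
    refine h.injective.sumElim (h.side_injective.sumElim hy_inj fun i b hib ↦ (hy b).2 ⟨i, hib⟩) ?_
    rintro i (j | b) hij
    exacts [h.side_ne_cycle j i hij.symm, (hy b).1 ⟨i, hij⟩]
  have hle : heawood ≤ G.comap f := by
    refine fromRel_le_comap ?_
    rintro (i | i | b) (j | j | b') hst <;> first | exact hst.elim | obtain rfl := hst
    exacts [h.adj_succ i, h.adj_side i, side_adj_side h hopp i, hadj i]
  refine nonempty_iso_of_valence_le hG (f := ⟨f, @hle⟩) hf (fun w ↦ Set.toFinite _) fun w ↦ ?_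
  rw [h3, valence_heawood]

end IsFrame

end OppositeSides

theorem exists_isDistinguishingSet_of_valence_three (hG : G.Connected)
    (h3 : ∀ v, valence G v = 3) (hcycle : ¬ G.IsAcyclic) (hg : 6 ≤ G.egirth) :
    ∃ S, IsDistinguishingSet G S := by
  obtain ⟨g, c, hc⟩ := exists_isGirthCycle hcycle
  rw [hc.egirth_eq] at hg
  obtain ⟨u, h⟩ := hc.exists_isFrame (by exact_mod_cast hg) h3
  by_contra hS
  have hopp {g : ℕ} {c u : ZMod g → V} (h : IsFrame G g c u) : G.Adj (u 0) (u 3) :=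
    not_not.mp fun hside ↦ hS (exists_isDistinguishingSet_of_frame h hG h3 hside)
  obtain rfl : g = 6 := (h.eq_six_of_side_adj_side (hopp h)).1
  obtain ⟨e⟩ := h.nonempty_heawood_iso hopp h3 hG
  exact hS ⟨_, isDistinguishingSet_heawoodSet.image e⟩

theorem exists_isDistinguishingSet_of_two_le_valence (hG : G.Connected)
    (h2 : ∀ v, 2 ≤ valence G v) (h3 : ∀ v, valence G v ≤ 3) (hcycle : ¬ G.IsAcyclic)
    (hg : 6 ≤ G.egirth) : ∃ S, IsDistinguishingSet G S := by
  have hg' : 4 < G.egirth := hg.trans_lt' (by norm_num)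
  by_cases hall : ∀ v, valence G v = 2
  · exact exists_isDistinguishingSet_of_valence_two hG hall hcycle hg
  obtain ⟨z, hz⟩ := not_forall.mp hall
  by_cases hr : ∃ r, valence G r = 2
  · obtain ⟨r, hr⟩ := hr
    by_cases hiso : ∀ x y, G.Adj x y → valence G x = 2 → valence G y ≠ 2
    · exact exists_isDistinguishingSet_of_isolated_valence_two hG h2 h3 hg' hiso hr
    · push Not at hiso
      obtain ⟨x, y, hxy, hx, hy⟩ := hiso
      exact exists_isDistinguishingSet_of_adj_valence_two hG h3 hg' hxy hx hy hz
  · push Not at hr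
    refine exists_isDistinguishingSet_of_valence_three hG (fun v ↦ (h3 v).antisymm ?_) hcycle hg
    exact Order.add_one_le_of_lt ((h2 v).lt_of_ne (hr v).symm)

section Extension

variable {B : Set V}

theorem notMem_of_twin (hG : G.Connected) (hB : B.Nonempty) {u w : V}
    (h : (twinGraph G B).Adj u w) : u ∉ B := by
  obtain ⟨-, p, hu, -⟩ := h
  have hpu : p ∈ parents G B u := hu ▸ rfl
  rw [← level_eq_zero_iff hG hB, ← hpu.2]
  omega

theorem IsDistinguishingSet.eq_self_of_induce {T : Set B}
    (hT : IsDistinguishingSet (G.induce B) T) {φ : G ≃g G} (hφB : ∀ v, φ v ∈ B ↔ v ∈ B)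
    (hφT : ∀ v, φ v ∈ Subtype.val '' T ↔ v ∈ Subtype.val '' T) {v : V} (hv : v ∈ B) :
    φ v = v := by
  let ψ : G.induce B ≃g G.induce B :=
    { toEquiv := φ.toEquiv.subtypeEquiv fun v ↦ (hφB v).symm
      map_rel_iff' := φ.map_adj_iff }
  have hψ (w : B) : ψ w ∈ T ↔ w ∈ T := by
    rw [← Subtype.val_injective.mem_set_image, ← Subtype.val_injective.mem_set_image (a := w)]
    exact hφT w
  exact congrArg Subtype.val (hT ψ hψ ⟨v, hv⟩)

theorem IsDistinguishingSet.exists_of_induce (hG : G.Connected) (hg : 4 < G.egirth)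
    (hB : B.Nonempty) (hφB : ∀ (φ : G ≃g G) (v : V), φ v ∈ B ↔ v ∈ B)
    (hM : IsMatching (twinGraph G B)) {T : Set B} (hT : IsDistinguishingSet (G.induce B) T) :
    ∃ S, IsDistinguishingSet G S := by
  obtain ⟨S₀, hS₀, -⟩ := exists_set_separating hM hM
  have hTB : Subtype.val '' T ⊆ B := by
    rintro _ ⟨v, -, rfl⟩
    exact v.2
  refine ⟨Subtype.val '' T ∪ S₀ \ B, fun φ hφ ↦ eq_self_of_not_twin hG hB hg (fun v hv ↦ ?_) ?_⟩
  · refine hT.eq_self_of_induce (hφB φ) (fun w ↦ ?_) hv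
    have := hφ w
    have := hφB φ w
    have := @hTB w
    have := @hTB (φ w)
    grind
  · intro v hv
    have hv_mem := hφ v
    have hsep := hS₀ v (φ v) hv
    have hvB := notMem_of_twin hG hB hv
    have := hφB φ v
    have := @hTB v
    have := @hTB (φ v)
    grind

end Extension

section TwoCore

/-- The 2-core of `G`: the largest set of vertices that induces a subgraph of minimum valence at
least two. -/
def twoCore (G : SimpleGraph V) : Set V :=
  ⋃₀ {S | ∀ v ∈ S, 2 ≤ (G.neighborSet v ∩ S).encard}

theorem subset_twoCore {S : Set V} (hS : ∀ v ∈ S, 2 ≤ (G.neighborSet v ∩ S).encard) :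
    S ⊆ twoCore G :=
  Set.subset_sUnion_of_mem hS

theorem two_le_encard_neighborSet_inter_twoCore {v : V} (hv : v ∈ twoCore G) :
    2 ≤ (G.neighborSet v ∩ twoCore G).encard := by
  obtain ⟨S, hS, hvS⟩ := hv
  exact (hS v hvS).trans (Set.encard_le_encard (Set.inter_subset_inter_right _ (subset_twoCore hS)))

theorem map_mem_twoCore (φ : G ≃g G) {v : V} (hv : v ∈ twoCore G) : φ v ∈ twoCore G := by
  refine subset_twoCore (S := φ '' twoCore G) ?_ ⟨v, hv, rfl⟩
  rintro _ ⟨x, hx, rfl⟩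
  rw [neighborSet_map, ← Set.image_inter φ.injective, φ.injective.encard_image]
  exact two_le_encard_neighborSet_inter_twoCore hx

theorem map_mem_twoCore_iff (φ : G ≃g G) (v : V) : φ v ∈ twoCore G ↔ v ∈ twoCore G :=
  ⟨fun h ↦ by simpa using map_mem_twoCore φ.symm h, map_mem_twoCore φ⟩

theorem support_subset_twoCore_of_isPath {v w : V} (hv : v ∈ twoCore G) (hw : w ∈ twoCore G)
    {p : G.Walk v w} (hp : p.IsPath) {x : V} (hx : x ∈ p.support) : x ∈ twoCore G := by
  refine subset_twoCore (S := twoCore G ∪ {x | x ∈ p.support}) (fun y hy ↦ ?_) (Or.inr hx)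
  by_cases hyc : y ∈ twoCore G
  · exact (two_le_encard_neighborSet_inter_twoCore hyc).trans
      (Set.encard_le_encard (Set.inter_subset_inter_right _ Set.subset_union_left))
  · obtain ⟨i, rfl, hi⟩ := Walk.mem_support_iff_exists_getVert.mp (hy.resolve_left hyc)
    have h0 : i ≠ 0 := by
      rintro rfl
      exact hyc (by rwa [Walk.getVert_zero])
    have hl : i ≠ p.length := by
      rintro rfl
      exact hyc (by rwa [Walk.getVert_length])
    obtain ⟨j, rfl⟩ := Nat.exists_eq_succ_of_ne_zero h0
    refine Order.add_one_le_of_lt <| Set.one_lt_encard_iff.mpr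
      ⟨p.getVert j, p.getVert (j + 2), ?_, ?_, fun h ↦ ?_⟩
    · exact ⟨(p.adj_getVert_succ (by omega)).symm, Or.inr (p.getVert_mem_support _)⟩
    · exact ⟨p.adj_getVert_succ (by omega), Or.inr (p.getVert_mem_support _)⟩
    · have := hp.getVert_injOn (show j ≤ p.length by omega) (show j + 2 ≤ p.length by omega) h
      omega

theorem connected_induce_twoCore (hG : G.Connected) (hcore : (twoCore G).Nonempty) :
    (G.induce (twoCore G)).Connected := by
  classical
  have := hcore.to_subtype
  refine ⟨fun a b ↦ ?_⟩
  obtain ⟨p⟩ := hG.preconnected a b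
  exact ⟨p.toPath.1.induce _ fun x hx ↦ support_subset_twoCore_of_isPath a.2 b.2 p.toPath.2 hx⟩

theorem valence_induce (s : Set V) (v : s) :
    valence (G.induce s) v = (G.neighborSet v ∩ s).encard := by
  rw [valence, ← Subtype.val_injective.encard_image]
  congr 1
  ext w
  simp [and_comm]

theorem support_subset_twoCore_of_isCycle {v : V} {p : G.Walk v v} (hp : p.IsCycle) {x : V}
    (hx : x ∈ p.support) : x ∈ twoCore G := by
  refine subset_twoCore (S := {x | x ∈ p.support}) (fun y hy ↦ ?_) hx
  have hsub : p.toSubgraph.neighborSet y ⊆ G.neighborSet y ∩ {x | x ∈ p.support} :=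
    fun z hz ↦ ⟨hz.adj_sub, p.mem_verts_toSubgraph.mp hz.snd_mem⟩
  calc (2 : ℕ∞) = (p.toSubgraph.neighborSet y).ncard := by
        rw [hp.ncard_neighborSet_toSubgraph_eq_two hy]
        rfl
    _ ≤ (p.toSubgraph.neighborSet y).encard := Set.ncard_le_encard _
    _ ≤ _ := Set.encard_le_encard hsub

theorem nonempty_twoCore (hG : ¬ G.IsAcyclic) : (twoCore G).Nonempty := by
  simp only [IsAcyclic, not_forall, not_not] at hG
  obtain ⟨v, p, hp⟩ := hG
  exact ⟨v, support_subset_twoCore_of_isCycle hp p.start_mem_support⟩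

theorem not_isAcyclic_induce_twoCore (hG : ¬ G.IsAcyclic) :
    ¬ (G.induce (twoCore G)).IsAcyclic := by
  simp only [IsAcyclic, not_forall, not_not] at hG ⊢
  obtain ⟨v, p, hp⟩ := hG
  refine ⟨_, p.induce _ fun x hx ↦ support_subset_twoCore_of_isCycle hp hx, ?_⟩
  rw [← Walk.isCycle_map_iff_of_injective (f := (Embedding.induce _).toHom) Subtype.val_injective]
  exact (p.map_induce _).symm ▸ hp

theorem exists_isDistinguishingSet_induce_twoCore (hG : G.Connected)
    (h3 : ∀ v, valence G v ≤ 3) (hcycle : ¬ G.IsAcyclic) (hg : 6 ≤ G.egirth) :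
    ∃ S, IsDistinguishingSet (G.induce (twoCore G)) S := by
  refine exists_isDistinguishingSet_of_two_le_valence
    (connected_induce_twoCore hG (nonempty_twoCore hcycle)) (fun v ↦ ?_) (fun v ↦ ?_)
    (not_isAcyclic_induce_twoCore hcycle)
    (hg.trans (Embedding.induce (twoCore G)).isContained.egirth_le)
  · rw [valence_induce]
    exact two_le_encard_neighborSet_inter_twoCore v.2
  · rw [valence_induce]
    exact (Set.encard_le_encard Set.inter_subset_left).trans (h3 v)

theorem encard_neighborSet_diff_twoCore_le (h3 : ∀ v, valence G v ≤ 3) {v : V}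
    (hv : v ∈ twoCore G) : (G.neighborSet v \ twoCore G).encard ≤ 2 := by
  have hsum := Set.encard_sdiff_add_encard_inter (G.neighborSet v) (twoCore G)
  have hle : (G.neighborSet v \ twoCore G).encard + 2 ≤ 1 + 2 :=
    (add_le_add_right (two_le_encard_neighborSet_inter_twoCore hv) _).trans (hsum.trans_le (h3 v))
  exact ((ENat.add_le_add_iff_right (by decide)).mp hle).trans (by norm_num)

theorem exists_isDistinguishingSet (hG : G.Connected) (h3 : ∀ v, valence G v ≤ 3)
    (hcycle : ¬ G.IsAcyclic) (hg : 6 ≤ G.egirth) : ∃ S, IsDistinguishingSet G S := by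
  obtain ⟨T, hT⟩ := exists_isDistinguishingSet_induce_twoCore hG h3 hcycle hg
  have hM := isMatching_twinGraph hG (nonempty_twoCore hcycle) h3
    fun v hv ↦ encard_neighborSet_diff_twoCore_le h3 hv
  exact hT.exists_of_induce hG (hg.trans_lt' (by norm_num)) (nonempty_twoCore hcycle)
    map_mem_twoCore_iff hM

end TwoCore

theorem distinguishingNumber_le {k : ℕ} {c : V → Fin k} (hc : IsDistinguishing G c) :
    distinguishingNumber G ≤ k :=
  iInf₂_le k ⟨c, hc⟩

theorem IsDistinguishingSet.distinguishingNumber_le {S : Set V} (hS : IsDistinguishingSet G S) :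
    distinguishingNumber G ≤ 2 := by
  classical
  refine SubcubicGraph.distinguishingNumber_le (k := 2) (c := fun v ↦ if v ∈ S then 0 else 1)
    fun φ hφ ↦ hS φ fun v ↦ ?_
  have hcolor : (if φ v ∈ S then (0 : Fin 2) else 1) = if v ∈ S then 0 else 1 := hφ v
  split_ifs at hcolor <;> simp_all

theorem two_le_distinguishingNumber {φ : G ≃g G} {v : V} (hv : φ v ≠ v) :
    2 ≤ distinguishingNumber G := by
  refine le_iInf₂ fun k ⟨c, hc⟩ ↦ ?_
  by_contra! hk
  have hk : k < 2 := by exact_mod_cast hk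
  have : Subsingleton (Fin k) := Fin.subsingleton_iff_le_one.mpr (by omega)
  exact hv (hc φ (fun _ ↦ Subsingleton.elim _ _) v)

theorem distinguishingNumber_le_one (h : ∀ (φ : G ≃g G) (v : V), φ v = v) :
    distinguishingNumber G ≤ 1 :=
  distinguishingNumber_le (k := 1) (c := fun _ ↦ 0) fun φ _ ↦ h φ

end SubcubicGraph

theorem corollary2p5 {V : Type*} (G : SimpleGraph V)
    (hconn : G.Connected) (hval : HasMaxValence G 3)
    (hcycle : ¬ G.IsAcyclic) (hgirth : 6 ≤ G.egirth) :
    distinguishingNumber G ≤ 2 ∧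
      (distinguishingNumber G = 2 ↔ ∃ φ : G ≃g G, ∃ v, φ v ≠ v) := by
  obtain ⟨S, hS⟩ := SubcubicGraph.exists_isDistinguishingSet hconn hval.1 hcycle hgirth
  have hle := hS.distinguishingNumber_le
  refine ⟨hle, fun h2 ↦ ?_, fun ⟨φ, v, hv⟩ ↦ ?_⟩
  · by_contra! h
    have h1 := SubcubicGraph.distinguishingNumber_le_one h
    rw [h2] at h1
    exact absurd h1 (by decide)
  · exact hle.antisymm (SubcubicGraph.two_le_distinguishingNumber hv)
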